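/- Let $M$ be a compact smooth manifold (Hausdorff, without boundary) of real dimension $2n$, let $\omega$ be a symplectic form on $M$, i.e. a smooth, closed, nondegenerate real $2$-form, and let $J$ be a smooth almost complex structure on $M$ that is calibrated by $\omega$, i.e. $\omega_x(u,Ju)>0$ and $\omega_x(Ju,Jv)=\omega_x(u,v)$ for all $x\in M$ and all $u,v\in T_xM$, the first for $u\neq 0$. Then $J$ is $\mathcal{C}^\infty$ pure, that is, $$H^{1,1}_J(M)_{\mathbb R}\cap H^{(2,0),(0,2)}_J(M)_{\mathbb R}=0 \quad\text{in } H^2(M,\mathbb R),$$ where $H^{1,1}_J(M)_{\mathbb R}$ is the space of de Rham classes that have a closed $J$-invariant representative (a closed real $2$-form $\alpha$ with $\alpha(Ju,Jv)=\alpha(u,v)$), and $H^{(2,0),(0,2)}_J(M)_{\mathbb R}$ is the space of de Rham classes that have a closed $J$-anti-invariant representative (a closed real $2$-form $\beta$ with $\beta(Ju,Jv)=-\beta(u,v)$). -/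

import Mathlib

open scoped Manifold ContDiff Topology

noncomputable section

namespace DeRham

section Forms

variable {E : Type*} [NormedAddCommGroup E] [NormedSpace ℝ E]
variable {M : Type*} [TopologicalSpace M] [ChartedSpace E M]
variable {k : ℕ}

variable (E M k) in
/-- Not necessarily smooth real differential `k`-forms on a manifold `M` modelled on `E`:
an alternating `k`-linear form on each tangent space. -/
abbrev RoughForm : Type _ :=
  ∀ x : M, TangentSpace 𝓘(ℝ, E) x [⋀^Fin k]→L[ℝ] ℝ

/-- The coordinate expression of a form in a chart `e`: its pullback by `e.symm`,
a `k`-form on (the open subset `e.target` of) the model space `E`. -/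
def coordRep (e : OpenPartialHomeomorph M E) (α : RoughForm E M k) (u : E) :
    E [⋀^Fin k]→L[ℝ] ℝ :=
  (α (e.symm u)).compContinuousLinearMap (mfderiv 𝓘(ℝ, E) 𝓘(ℝ, E) e.symm u)

/-- A form is smooth if its expression in each chart of the smooth structure is smooth. -/
def IsSmooth (α : RoughForm E M k) : Prop :=
  ∀ e ∈ IsManifold.maximalAtlas 𝓘(ℝ, E) ∞ M, ContDiffOn ℝ ∞ (coordRep e α) e.target

/-- The exterior derivative at `x`, computed in the preferred chart at `x`. By
`coordRep_roughExtDeriv` below, any other chart gives the same result. -/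
def roughExtDeriv (α : RoughForm E M k) : RoughForm E M (k + 1) := fun x ↦
  (extDeriv (coordRep (chartAt E x) α) (chartAt E x x)).compContinuousLinearMap
    (mfderiv 𝓘(ℝ, E) 𝓘(ℝ, E) (chartAt E x) x)

lemma coordRep_add (e : OpenPartialHomeomorph M E) (α β : RoughForm E M k) :
    coordRep e (α + β) = coordRep e α + coordRep e β := by
  ext u v; rfl

lemma coordRep_smul (e : OpenPartialHomeomorph M E) (c : ℝ) (α : RoughForm E M k) :
    coordRep e (c • α) = c • coordRep e α := by
  ext u v; rfl

lemma coordRep_zero (e : OpenPartialHomeomorph M E) :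
    coordRep e (0 : RoughForm E M k) = 0 := by
  ext u v; rfl

variable (E M k) in
/-- The smooth forms, as a real subspace of all forms. -/
def smoothForms : Submodule ℝ (RoughForm E M k) where
  carrier := {α | IsSmooth α}
  add_mem' {α β} hα hβ e he := by
    rw [coordRep_add]; exact (hα e he).add (hβ e he)
  zero_mem' e _ := by
    rw [coordRep_zero]; exact contDiffOn_const
  smul_mem' c α hα e he := by
    rw [coordRep_smul]; exact contDiffOn_const.smul (hα e he)

variable (E M k) in
/-- `Ω^k(M)_ℝ`: the real vector space of smooth real differential `k`-forms on `M`. -/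
def Form : Type _ := smoothForms E M k

instance : AddCommGroup (Form E M k) := inferInstanceAs (AddCommGroup (smoothForms E M k))

instance : Module ℝ (Form E M k) := inferInstanceAs (Module ℝ (smoothForms E M k))

/-- The value of a smooth form at a point of the manifold. -/
instance : CoeFun (Form E M k) (fun _ ↦ RoughForm E M k) := ⟨fun α ↦ α.1⟩

lemma IsSmooth.differentiableAt {α : RoughForm E M k} (hα : IsSmooth α)
    {e : OpenPartialHomeomorph M E} (he : e ∈ IsManifold.maximalAtlas 𝓘(ℝ, E) ∞ M)
    {u : E} (hu : u ∈ e.target) : DifferentiableAt ℝ (coordRep e α) u :=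
  ((hα e he).contDiffAt (e.open_target.mem_nhds hu)).differentiableAt (by simp)

section

lemma two_le_smooth : minSmoothness ℝ 2 ≤ ∞ := by
  rw [minSmoothness_of_isRCLikeNormedField]
  exact WithTop.coe_le_coe.2 le_top

lemma mdifferentiableAt_chart {e : OpenPartialHomeomorph M E}
    (he : e ∈ IsManifold.maximalAtlas 𝓘(ℝ, E) ∞ M) {x : M} (hx : x ∈ e.source) :
    MDifferentiableAt 𝓘(ℝ, E) 𝓘(ℝ, E) e x :=
  (contMDiffAt_of_mem_maximalAtlas he hx).mdifferentiableAt (by simp)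

lemma mdifferentiableAt_chart_symm {e : OpenPartialHomeomorph M E}
    (he : e ∈ IsManifold.maximalAtlas 𝓘(ℝ, E) ∞ M) {u : E} (hu : u ∈ e.target) :
    MDifferentiableAt 𝓘(ℝ, E) 𝓘(ℝ, E) e.symm u :=
  (contMDiffAt_symm_of_mem_maximalAtlas he hu).mdifferentiableAt (by simp)

lemma roughForm_congr (α : RoughForm E M k) {x y : M} (h : x = y) (v : Fin k → E) :
    (α x : E [⋀^Fin k]→L[ℝ] ℝ) v = (α y : E [⋀^Fin k]→L[ℝ] ℝ) v := by
  subst h; rfl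

/-- Change of coordinates. -/
lemma coordRep_eventuallyEq (α : RoughForm E M k) {e e' : OpenPartialHomeomorph M E}
    (he : e ∈ IsManifold.maximalAtlas 𝓘(ℝ, E) ∞ M)
    (he' : e' ∈ IsManifold.maximalAtlas 𝓘(ℝ, E) ∞ M)
    {u : E} (hu : u ∈ e.target) (hu' : e.symm u ∈ e'.source) :
    coordRep e α =ᶠ[𝓝 u] fun w ↦
      (coordRep e' α (e' (e.symm w))).compContinuousLinearMap
        (fderiv ℝ (fun z ↦ e' (e.symm z)) w) := by
  have hev : ∀ᶠ w in 𝓝 u, w ∈ e.target ∧ e.symm w ∈ e'.source :=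
    Filter.Eventually.and (e.open_target.mem_nhds hu)
      ((e.continuousAt_symm hu).eventually (e'.open_source.mem_nhds hu'))
  filter_upwards [hev.eventually_nhds] with w hw
  obtain ⟨hwt, hws⟩ := hw.self_of_nhds
  have h1 := mdifferentiableAt_chart he' hws
  have h2 := mdifferentiableAt_chart_symm he hwt
  have h3 := mdifferentiableAt_chart_symm he' (e'.map_source hws)
  have h12 : MDifferentiableAt 𝓘(ℝ, E) 𝓘(ℝ, E) (fun z ↦ e' (e.symm z)) w := h1.comp w h2
  have hcomp : mfderiv 𝓘(ℝ, E) 𝓘(ℝ, E) (e'.symm ∘ fun z ↦ e' (e.symm z)) w =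
      (mfderiv 𝓘(ℝ, E) 𝓘(ℝ, E) e'.symm (e' (e.symm w))).comp
        (mfderiv 𝓘(ℝ, E) 𝓘(ℝ, E) (fun z ↦ e' (e.symm z)) w) := mfderiv_comp w h3 h12
  have heq : (e'.symm ∘ fun z ↦ e' (e.symm z)) =ᶠ[𝓝 w] e.symm := by
    filter_upwards [hw] with z hz
    exact e'.left_inv hz.2
  rw [mfderiv_eq_fderiv] at hcomp
  ext v
  have hv : ∀ a : E, (mfderiv 𝓘(ℝ, E) 𝓘(ℝ, E) e.symm w : E →L[ℝ] E) a =
      (mfderiv 𝓘(ℝ, E) 𝓘(ℝ, E) e'.symm (e' (e.symm w)) : E →L[ℝ] E)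
        (fderiv ℝ (fun z ↦ e' (e.symm z)) w a) := by
    intro a
    have := heq.mfderiv_eq (I := 𝓘(ℝ, E)) (I' := 𝓘(ℝ, E))
    exact (DFunLike.congr_fun (show (mfderiv 𝓘(ℝ, E) 𝓘(ℝ, E) e.symm w : E →L[ℝ] E) =
      ((mfderiv 𝓘(ℝ, E) 𝓘(ℝ, E) e'.symm (e' (e.symm w)) : E →L[ℝ] E).comp
        (fderiv ℝ (fun z ↦ e' (e.symm z)) w)) from this.symm.trans hcomp) a)
  have hp := roughForm_congr α (e'.left_inv hws)
    (fun i ↦ (mfderiv 𝓘(ℝ, E) 𝓘(ℝ, E) e.symm w : E →L[ℝ] E) (v i))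
  refine hp.symm.trans ?_
  refine congrArg (α (e'.symm (e' (e.symm w))) : E [⋀^Fin k]→L[ℝ] ℝ) ?_
  funext i
  exact hv (v i)

variable [IsManifold 𝓘(ℝ, E) ∞ M]

/-- In every chart of the smooth structure, the exterior derivative of a smooth form is given by
the usual coordinate formula. -/
theorem coordRep_roughExtDeriv {α : RoughForm E M k} (hα : IsSmooth α)
    {e : OpenPartialHomeomorph M E} (he : e ∈ IsManifold.maximalAtlas 𝓘(ℝ, E) ∞ M)
    {u : E} (hu : u ∈ e.target) :
    coordRep e (roughExtDeriv α) u = extDeriv (coordRep e α) u := by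
  set x := e.symm u with hx
  set c := chartAt E x with hc
  have hcm : c ∈ IsManifold.maximalAtlas 𝓘(ℝ, E) ∞ M :=
    IsManifold.chart_mem_maximalAtlas x
  have hxs : x ∈ c.source := mem_chart_source E x
  have hcx : MDifferentiableAt 𝓘(ℝ, E) 𝓘(ℝ, E) c x := mdifferentiableAt_chart hcm hxs
  have hsm : ContDiffAt ℝ ∞ (fun z ↦ c (e.symm z)) u := by
    rw [← contMDiffAt_iff_contDiffAt]
    exact (contMDiffAt_of_mem_maximalAtlas hcm hxs).comp u
      (contMDiffAt_symm_of_mem_maximalAtlas he hu)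
  rw [(coordRep_eventuallyEq α he hcm hu hxs).extDeriv_eq,
    extDeriv_pullback (f := fun z ↦ c (e.symm z)) (r := ∞)
      (hα.differentiableAt hcm (c.map_source hxs)) hsm two_le_smooth]
  have hcomp : mfderiv 𝓘(ℝ, E) 𝓘(ℝ, E) (c ∘ e.symm) u =
      (mfderiv 𝓘(ℝ, E) 𝓘(ℝ, E) c x).comp (mfderiv 𝓘(ℝ, E) 𝓘(ℝ, E) e.symm u) :=
    mfderiv_comp u hcx (mdifferentiableAt_chart_symm he hu)
  rw [mfderiv_eq_fderiv] at hcomp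
  ext v
  refine congrArg (extDeriv (coordRep c α) (c x)) ?_
  funext i
  exact (DFunLike.congr_fun hcomp (v i)).symm

theorem IsSmooth.roughExtDeriv {α : RoughForm E M k} (hα : IsSmooth α) :
    IsSmooth (roughExtDeriv α) := by
  intro e he
  have h : ContDiffOn ℝ ∞ (fun u ↦ extDeriv (coordRep e α) u) e.target :=
    (ContinuousAlternatingMap.alternatizeUncurryFinCLM ℝ E ℝ).contDiff.comp_contDiffOn
      ((hα e he).fderiv_of_isOpen e.open_target (by simp))
  exact h.congr fun u hu ↦ coordRep_roughExtDeriv hα he hu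

variable (E M k) in
/-- The exterior derivative `d : Ω^k(M)_ℝ → Ω^{k+1}(M)_ℝ`. -/
def d : Form E M k →ₗ[ℝ] Form E M (k + 1) where
  toFun α := ⟨roughExtDeriv α.1, IsSmooth.roughExtDeriv α.2⟩
  map_add' α β := by
    refine Subtype.ext (funext fun x ↦ ?_)
    have hm := IsManifold.chart_mem_maximalAtlas (I := 𝓘(ℝ, E)) (n := ∞) x
    have hx := (chartAt E x).map_source (mem_chart_source E x)
    have h := extDeriv_add (IsSmooth.differentiableAt α.2 hm hx)
      (IsSmooth.differentiableAt β.2 hm hx)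
    change (extDeriv (coordRep (chartAt E x) (α.1 + β.1)) _).compContinuousLinearMap _ = _
    rw [coordRep_add, h]
    rfl
  map_smul' c α := by
    refine Subtype.ext (funext fun x ↦ ?_)
    have h := extDeriv_smul c (coordRep (chartAt E x) α.1) (x := chartAt E x x)
    change (extDeriv (coordRep (chartAt E x) (c • α.1)) _).compContinuousLinearMap _ = _
    rw [coordRep_smul, h]
    rfl

variable (E M k) in
/-- The space `Z^k` of closed smooth `k`-forms. -/
def closedForms : Submodule ℝ (Form E M k) := LinearMap.ker (d E M k)

variable (E M k) in
/-- The space `B^{k+1}` of exact smooth `(k+1)`-forms. -/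
def exactForms : Submodule ℝ (Form E M (k + 1)) := LinearMap.range (d E M k)

/-- `d ∘ d = 0`. -/
theorem d_d (α : Form E M k) : d E M (k + 1) (d E M k α) = 0 := by
  refine Subtype.ext (funext fun x ↦ ?_)
  have hm := IsManifold.chart_mem_maximalAtlas (I := 𝓘(ℝ, E)) (n := ∞) x
  have hx := (chartAt E x).map_source (mem_chart_source E x)
  have hev : coordRep (chartAt E x) (roughExtDeriv α.1) =ᶠ[𝓝 (chartAt E x x)]
      extDeriv (coordRep (chartAt E x) α.1) := by
    filter_upwards [(chartAt E x).open_target.mem_nhds hx] with u hu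
    exact coordRep_roughExtDeriv α.2 hm hu
  have h0 : extDeriv (extDeriv (coordRep (chartAt E x) α.1)) (chartAt E x x) = 0 :=
    extDeriv_extDeriv_apply (r := ∞)
      ((α.2 _ hm).contDiffAt ((chartAt E x).open_target.mem_nhds hx)) two_le_smooth
  change roughExtDeriv (roughExtDeriv α.1) x = 0
  rw [DeRham.roughExtDeriv, hev.extDeriv_eq, h0]
  rfl

theorem exactForms_le_closedForms : exactForms E M k ≤ closedForms E M (k + 1) := by
  rintro _ ⟨γ, rfl⟩
  exact d_d γ

variable (E M k) in
/-- The de Rham cohomology space `H^{k+1}(M, ℝ)`, closed forms modulo exact forms. -/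
abbrev Cohomology : Type _ :=
  closedForms E M (k + 1) ⧸ (exactForms E M k).submoduleOf (closedForms E M (k + 1))

end

end Forms

end DeRham

open DeRham

section AlmostComplex

variable (E : Type*) [NormedAddCommGroup E] [NormedSpace ℝ E]
variable (M : Type*) [TopologicalSpace M] [ChartedSpace E M] [IsManifold 𝓘(ℝ, E) ∞ M]

/-- A smooth almost complex structure on `M`: a smooth field of endomorphisms of the
tangent spaces with square `-1`. -/
structure AlmostComplexStructure where
  /-- the underlying smooth section of the bundle `End(TM)` -/
  toSection : ContMDiffSection 𝓘(ℝ, E) (E →L[ℝ] E) ∞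
    (fun x : M ↦ TangentSpace 𝓘(ℝ, E) x →L[ℝ] TangentSpace 𝓘(ℝ, E) x)
  sq_eq_neg' : ∀ (x : M) (u : TangentSpace 𝓘(ℝ, E) x),
    toSection x (toSection x u) = -u

variable {E M}

instance : CoeFun (AlmostComplexStructure E M) (fun _ ↦
    ∀ x : M, TangentSpace 𝓘(ℝ, E) x →L[ℝ] TangentSpace 𝓘(ℝ, E) x) :=
  ⟨fun J ↦ J.toSection⟩

/-- A symplectic form: a smooth, closed, nondegenerate 2-form. -/
structure IsSymplectic (σ : Form E M 2) : Prop where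
  closed : d E M 2 σ = 0
  nondegenerate : ∀ (x : M) (u : TangentSpace 𝓘(ℝ, E) x), (∀ v, σ x ![u, v] = 0) → u = 0

namespace AlmostComplexStructure

/-- `J` is calibrated by `σ`: it is tamed by `σ` and `σ` is `J`-invariant. -/
structure IsCalibratedBy (J : AlmostComplexStructure E M) (σ : Form E M 2) : Prop where
  tamed : ∀ (x : M) (u : TangentSpace 𝓘(ℝ, E) x), u ≠ 0 → 0 < σ x ![u, J x u]
  invariant : ∀ (x : M) (u v : TangentSpace 𝓘(ℝ, E) x),
    σ x ![J x u, J x v] = σ x ![u, v]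

/-- The closed `J`-invariant real 2-forms, that is, the closed real forms of type `(1,1)`. -/
def closedInvariant (J : AlmostComplexStructure E M) : Submodule ℝ (closedForms E M 2) where
  carrier := {α | ∀ (x : M) (u v : TangentSpace 𝓘(ℝ, E) x),
    α.1 x ![J x u, J x v] = α.1 x ![u, v]}
  add_mem' {α β} hα hβ x u v := by
    have h := congrArg₂ (· + ·) (hα x u v) (hβ x u v)
    exact h
  zero_mem' x u v := rfl
  smul_mem' c α hα x u v := congrArg (c * ·) (hα x u v)

/-- The closed `J`-anti-invariant real 2-forms, that is, the closed real forms
of type `(2,0) + (0,2)`. -/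
def closedAntiInvariant (J : AlmostComplexStructure E M) :
    Submodule ℝ (closedForms E M 2) where
  carrier := {α | ∀ (x : M) (u v : TangentSpace 𝓘(ℝ, E) x),
    α.1 x ![J x u, J x v] = -α.1 x ![u, v]}
  add_mem' {α β} hα hβ x u v := by
    have h := congrArg₂ (· + ·) (hα x u v) (hβ x u v)
    exact h.trans (neg_add _ _).symm
  zero_mem' x u v := neg_zero.symm
  smul_mem' c α hα x u v := (congrArg (c * ·) (hα x u v)).trans (mul_neg _ _)

/-- `H^{1,1}_J(M)_ℝ`: the classes that have a closed `J`-invariant representative. -/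
def cohomologyInvariant (J : AlmostComplexStructure E M) : Submodule ℝ (Cohomology E M 1) :=
  J.closedInvariant.map (Submodule.mkQ _)

/-- `H^{(2,0),(0,2)}_J(M)_ℝ`: the classes that have a closed `J`-anti-invariant
representative. -/
def cohomologyAntiInvariant (J : AlmostComplexStructure E M) :
    Submodule ℝ (Cohomology E M 1) :=
  J.closedAntiInvariant.map (Submodule.mkQ _)

/-- `J` is `C^∞` pure: `H^{1,1}_J(M)_ℝ ∩ H^{(2,0),(0,2)}_J(M)_ℝ = 0`. -/
def IsSmoothPure (J : AlmostComplexStructure E M) : Prop :=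
  J.cohomologyInvariant ⊓ J.cohomologyAntiInvariant = ⊥

end AlmostComplexStructure

end AlmostComplex

end

/-! Suppose a class has a closed invariant representative `α` and a closed anti-invariant one `β`,
so `α - β = dγ`. A symplectic form with matrix `S` pairs 2-forms pointwise by `tr (S⁻¹ ξ S⁻¹ β)`.
The operator `S⁻¹ α` commutes with `J` and `S⁻¹ β` anticommutes with it. Hence `α` and `β` are
pointwise orthogonal, and `β` is primitive, meaning `tr (S⁻¹ β) = 0`. For the metric `ω(·, J·)` the
operator `S⁻¹ β` is skew-adjoint, so the pairing of `β` with itself is nonpositive and vanishes only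
where `β` does. Thus the pairing of `dγ` with `β` is minus that of `β` with itself, a nonnegative
function.

Its integral over `M` against the symplectic volume is zero, because a closed primitive 2-form is
co-closed: the bivector density `|det S|^(1/2) S⁻¹ β S⁻¹` is divergence free
(`sum_divergence_eq_zero`, `sum_fderiv_dualDensity`). This replaces the Hodge star identity that
makes `*β` a multiple of `β ∧ ω^(n-2)`. Integrating by parts moves the derivative from `γ` to this
density. A continuous nonnegative function with zero integral vanishes, so `β = 0`, and the class is
zero.

Integration is done chart by chart with a finite partition of unity (`pairAt_exact_eq_zero`). The
density `|det S|^(1/2)` changes by the absolute Jacobian, which makes the chart integrals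
compatible. -/

namespace CalibratedPure

/-! ### Pointwise algebra of 2-forms as skew matrices -/

section MatrixAlgebra

open Matrix

variable {ι : Type*} [Fintype ι]

/-- Contracting a skew matrix with a closed family of skew matrices. -/
lemma sum_mul_mul_of_cyclic {A : Matrix ι ι ℝ} {T : ι → Matrix ι ι ℝ} (hA : Aᵀ = -A)
    (hT : ∀ k, (T k)ᵀ = -T k) (cT : ∀ i a b, T i a b + T a b i + T b i a = 0)
    (Q : Matrix ι ι ℝ) (j : ι) :
    ∑ i, (A * T i * Q) i j = 1 / 2 * ∑ b, trace (A * T b) * Q b j := by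
  have hA' : ∀ i a, A a i = -A i a := fun i a ↦ congrFun (congrFun hA i) a
  have hT' : ∀ k i a, T k a i = -T k i a := fun k i a ↦ congrFun (congrFun (hT k) i) a
  -- Exchanging `i` and `a` and using skewness twice gives a second expression for the same sum. The
  -- cyclic identity turns the sum of the two into `tr (A T_b)`, whence the factor `1 / 2`.
  have key : ∀ b, ∑ i, (A * T i) i b = 1 / 2 * trace (A * T b) := by
    intro b
    simp only [trace, diag_apply, mul_apply]
    have h1 : ∑ i, ∑ a, A i a * T i a b = ∑ i, ∑ a, A i a * T a b i := by
      rw [Finset.sum_comm]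
      refine Finset.sum_congr rfl fun i _ ↦ Finset.sum_congr rfl fun a _ ↦ ?_
      rw [hA' i a, hT' a b i]; ring
    have h2 : ∑ i, ∑ a, A i a * T i a b + ∑ i, ∑ a, A i a * T a b i =
        ∑ i, ∑ a, A i a * T b a i := by
      rw [← Finset.sum_add_distrib]
      refine Finset.sum_congr rfl fun i _ ↦ ?_
      rw [← Finset.sum_add_distrib]
      refine Finset.sum_congr rfl fun a _ ↦ ?_
      rw [hT' b i a]
      linear_combination A i a * cT i a b
    linarith
  simp_rw [mul_apply (M := A * T _)]
  rw [Finset.sum_comm, Finset.mul_sum]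
  refine Finset.sum_congr rfl fun b _ ↦ ?_
  rw [← Finset.sum_mul, key, mul_assoc]

/-- The algebraic identity behind the co-closedness of primitive closed 2-forms. -/
lemma sum_divergence_eq_zero {P β : Matrix ι ι ℝ} {dS dβ dP : ι → Matrix ι ι ℝ}
    (hP : Pᵀ = -P) (hβ : βᵀ = -β) (hdP : ∀ k, dP k = -(P * dS k * P))
    (hdS : ∀ k, (dS k)ᵀ = -dS k) (hdβ : ∀ k, (dβ k)ᵀ = -dβ k)
    (cS : ∀ i a b, dS i a b + dS a b i + dS b i a = 0)
    (cβ : ∀ i a b, dβ i a b + dβ a b i + dβ b i a = 0)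
    (htr : ∀ k, trace (dP k * β + P * dβ k) = 0) (j : ι) :
    ∑ i, (1 / 2 * trace (P * dS i) * (P * β * P) i j +
      (dP i * β * P + P * dβ i * P + P * β * dP i) i j) = 0 := by
  have hB : (P * β * P)ᵀ = -(P * β * P) := by
    simp [transpose_mul, hP, hβ, mul_assoc]
  -- `e1` cancels the derivative of the density against the `dP β P` term. `e2` and `e3` reduce the
  -- other two terms to traces, which `e4`, the derivative of `tr (P β) = 0`, makes cancel.
  have e1 := sum_mul_mul_of_cyclic hP hdS cS (P * β * P) j
  have e2 := sum_mul_mul_of_cyclic hP hdβ cβ P j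
  have e3 := sum_mul_mul_of_cyclic hB hdS cS P j
  have e4 : ∀ k, trace (P * dβ k) = trace (P * β * P * dS k) := by
    intro k
    have := htr k
    rw [trace_add, hdP, neg_mul, trace_neg] at this
    have h2 : trace (P * dS k * P * β) = trace (P * β * P * dS k) := by
      rw [mul_assoc (P * dS k), trace_mul_comm, ← mul_assoc]
    linarith
  have e5 : ∀ i, (dP i * β * P) i j = -(P * dS i * (P * β * P)) i j := by
    intro i; rw [hdP, ← neg_apply]; simp [mul_assoc]
  have e6 : ∀ i, (P * β * dP i) i j = -(P * β * P * dS i * P) i j := by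
    intro i; rw [hdP, ← neg_apply]; simp [mul_assoc]
  simp only [Matrix.add_apply, Finset.sum_add_distrib, e5, e6, Finset.sum_neg_distrib, e1, e2, e3, e4,
    mul_assoc (1 / 2 : ℝ), ← Finset.mul_sum]
  ring

variable [DecidableEq ι]

/-- The pairing of two 2-forms, given by their matrices, induced by a symplectic form. -/
noncomputable def pairing (S ξ β : Matrix ι ι ℝ) : ℝ := trace (S⁻¹ * ξ * S⁻¹ * β)

/-- The trace of `J A J` is `-tr A` by cyclicity and `tr A` by anticommutation. -/
lemma trace_eq_zero_of_anticommute {J A : Matrix ι ι ℝ} (hJ : J * J = -1) (h : J * A = -(A * J)) :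
    trace A = 0 := by
  have h1 : trace (J * A * J) = -trace A := by
    rw [trace_mul_comm, ← mul_assoc, hJ]; simp
  have h2 : trace (J * A * J) = trace A := by
    rw [h, neg_mul, mul_assoc, hJ]; simp
  linarith

/-! ### Linear algebra of a calibrated complex structure -/

section Calibrated

variable {S J α β : Matrix ι ι ℝ}

lemma transpose_mul_of_invariant (hJ : J * J = -1) (h : Jᵀ * S * J = S) : Jᵀ * S = -(S * J) := by
  have := congrArg (· * J) h
  simp only [mul_assoc, hJ] at this
  rw [← this]; simp

lemma transpose_mul_of_antiInvariant (hJ : J * J = -1) (h : Jᵀ * β * J = -β) :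
    Jᵀ * β = β * J := by
  have := congrArg (· * J) h
  simp only [mul_assoc, hJ] at this
  simpa using this

lemma mul_inv_of_invariant (hS : IsUnit S.det) (hJ : J * J = -1) (h : Jᵀ * S * J = S) :
    J * S⁻¹ = -(S⁻¹ * Jᵀ) := by
  have h1 := transpose_mul_of_invariant hJ h
  calc J * S⁻¹ = S⁻¹ * (S * J) * S⁻¹ := by rw [← mul_assoc, nonsing_inv_mul _ hS, one_mul]
    _ = S⁻¹ * (-(Jᵀ * S)) * S⁻¹ := by rw [h1, neg_neg]
    _ = -(S⁻¹ * Jᵀ) := by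
      rw [mul_neg, neg_mul, mul_assoc, mul_assoc, mul_nonsing_inv _ hS, mul_one]

/-- Moving `J` past `S⁻¹` and then past `α` costs a sign each time, and the signs cancel. For an
anti-invariant form only the first sign occurs. -/
lemma commute_of_invariant (hS : IsUnit S.det) (hJ : J * J = -1) (h : Jᵀ * S * J = S)
    (hα : Jᵀ * α * J = α) : J * (S⁻¹ * α) = S⁻¹ * α * J := by
  rw [← mul_assoc, mul_inv_of_invariant hS hJ h, neg_mul, mul_assoc,
    transpose_mul_of_invariant hJ hα, mul_neg, neg_neg, mul_assoc]

lemma anticommute_of_antiInvariant (hS : IsUnit S.det) (hJ : J * J = -1) (h : Jᵀ * S * J = S)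
    (hβ : Jᵀ * β * J = -β) : J * (S⁻¹ * β) = -(S⁻¹ * β * J) := by
  rw [← mul_assoc, mul_inv_of_invariant hS hJ h, neg_mul, mul_assoc,
    transpose_mul_of_antiInvariant hJ hβ, mul_assoc]

/-- Anti-invariant forms are primitive. -/
lemma trace_inv_mul_of_antiInvariant (hS : IsUnit S.det) (hJ : J * J = -1) (h : Jᵀ * S * J = S)
    (hβ : Jᵀ * β * J = -β) : trace (S⁻¹ * β) = 0 :=
  trace_eq_zero_of_anticommute hJ (anticommute_of_antiInvariant hS hJ h hβ)

/-- Invariant and anti-invariant forms are pointwise orthogonal. -/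
lemma pairing_invariant_antiInvariant (hS : IsUnit S.det) (hJ : J * J = -1) (h : Jᵀ * S * J = S)
    (hα : Jᵀ * α * J = α) (hβ : Jᵀ * β * J = -β) : pairing S α β = 0 := by
  -- The product of an operator commuting with `J` and one anticommuting with it anticommutes with
  -- `J`.
  refine trace_eq_zero_of_anticommute hJ ?_
  have h1 := commute_of_invariant hS hJ h hα
  have h2 := anticommute_of_antiInvariant hS hJ h hβ
  rw [mul_assoc, ← mul_assoc J, h1, mul_assoc, h2, mul_neg, mul_assoc (S⁻¹ * α)]

/-- In a `G`-orthonormal frame, given by `G = Rᵀ R`, the operator becomes a skew matrix `C`, and `tr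
A² = -tr (Cᵀ C)` is minus a sum of squares. -/
lemma trace_sq_of_skew_adjoint {G A : Matrix ι ι ℝ} (hG : G.PosDef) (h : Aᵀ * G = -(G * A)) :
    trace (A * A) ≤ 0 ∧ (trace (A * A) = 0 → A = 0) := by
  obtain ⟨R, hR, rfl⟩ : ∃ R : Matrix ι ι ℝ, IsUnit R ∧ G = Rᵀ * R := by
    open scoped MatrixOrder Matrix.Norms.L2Operator in
    obtain ⟨R, hR, h⟩ := CStarAlgebra.isStrictlyPositive_iff_eq_star_mul_self.mp
      hG.isStrictlyPositive
    exact ⟨R, hR, by simpa [star_eq_conjTranspose] using h⟩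
  have hd : IsUnit R.det := (isUnit_iff_isUnit_det R).1 hR
  set C := R * A * R⁻¹ with hC
  have hA : A = R⁻¹ * C * R := by
    rw [hC, mul_assoc, mul_assoc, mul_assoc, nonsing_inv_mul _ hd, mul_one, ← mul_assoc,
      nonsing_inv_mul _ hd, one_mul]
  have hCt : Cᵀ = -C := by
    have hRt : (R⁻¹)ᵀ * Rᵀ = 1 := by rw [← transpose_mul, mul_nonsing_inv _ hd, transpose_one]
    have h3 : (R⁻¹)ᵀ * (Aᵀ * (Rᵀ * R)) * R⁻¹ = Cᵀ := by
      rw [hC, transpose_mul, transpose_mul]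
      simp only [mul_assoc, mul_nonsing_inv _ hd, mul_one]
    rw [← h3, h]
    simp only [mul_neg, neg_mul, mul_assoc, hC]
    rw [← mul_assoc (R⁻¹)ᵀ, hRt, one_mul]
  clear_value C
  have hAA : trace (A * A) = -trace (Cᴴ * C) := by
    rw [conjTranspose_eq_transpose_of_trivial, hCt, neg_mul, trace_neg, neg_neg]
    conv_lhs => rw [hA]
    rw [mul_assoc (R⁻¹ * C), mul_assoc R⁻¹, ← mul_assoc R, ← mul_assoc R,
      mul_nonsing_inv _ hd, one_mul, trace_mul_comm R⁻¹, mul_assoc C, mul_assoc C,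
      mul_nonsing_inv _ hd, mul_one]
  rw [hAA]
  refine ⟨neg_nonpos.2 ?_, fun h0 ↦ ?_⟩
  · simp only [trace, diag_apply, mul_apply, conjTranspose_apply, star_trivial]
    exact Finset.sum_nonneg fun i _ ↦ Finset.sum_nonneg fun j _ ↦ mul_self_nonneg _
  · have : C = 0 := trace_conjTranspose_mul_self_eq_zero_iff.1 (neg_eq_zero.1 h0)
    rw [hA, this]; simp

/-- The pairing is definite on anti-invariant forms. -/
lemma pairing_antiInvariant_self (hSt : Sᵀ = -S) (hJ : J * J = -1) (h : Jᵀ * S * J = S)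
    (hG : ∀ x, x ≠ 0 → 0 < x ⬝ᵥ (S * J) *ᵥ x) (hS : IsUnit S.det)
    (hβt : βᵀ = -β) (hβ : Jᵀ * β * J = -β) :
    pairing S β β ≤ 0 ∧ (pairing S β β = 0 → β = 0) := by
  have h1 := transpose_mul_of_invariant hJ h
  -- `S J` is the matrix of the metric `ω(·, J·)`; its symmetry is skewness of `S` together with
  -- invariance.
  have hG' : (S * J).PosDef := by
    refine PosDef.of_dotProduct_mulVec_pos ?_ fun x hx ↦ by simpa using hG x hx
    rw [IsHermitian, conjTranspose_eq_transpose_of_trivial, transpose_mul, hSt, mul_neg, h1,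
      neg_neg]
  have hSi : (S⁻¹)ᵀ = -S⁻¹ := by
    rw [transpose_nonsing_inv, hSt]
    refine inv_eq_right_inv ?_
    rw [neg_mul_neg, mul_nonsing_inv _ hS]
  have hskew : (S⁻¹ * β)ᵀ * (S * J) = -(S * J * (S⁻¹ * β)) := by
    rw [transpose_mul, hSi, hβt, neg_mul_neg, mul_assoc β, ← mul_assoc S⁻¹, nonsing_inv_mul _ hS,
      one_mul, ← neg_mul, ← h1, mul_assoc Jᵀ, ← mul_assoc S, mul_nonsing_inv _ hS, one_mul,
      transpose_mul_of_antiInvariant hJ hβ]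
  have h2 := trace_sq_of_skew_adjoint hG' hskew
  rw [pairing, mul_assoc (S⁻¹ * β)]
  refine ⟨h2.1, fun h0 ↦ ?_⟩
  have := congrArg (S * ·) (h2.2 h0)
  simpa [← mul_assoc, mul_nonsing_inv _ hS] using this

end Calibrated

/-- The operator attached to a 2-form by the symplectic form is intrinsic: a change of basis only
conjugates it, so traces of products of such operators do not depend on coordinates. -/
lemma inv_mul_congr {D : Matrix ι ι ℝ} (hD : IsUnit D.det) (S ζ : Matrix ι ι ℝ) :
    (Dᵀ * S * D)⁻¹ * (Dᵀ * ζ * D) = D⁻¹ * (S⁻¹ * ζ) * D := by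
  have hDt : IsUnit (Dᵀ).det := by rwa [det_transpose]
  rw [Matrix.mul_inv_rev, Matrix.mul_inv_rev]
  simp only [mul_assoc]
  rw [← mul_assoc (Dᵀ)⁻¹, nonsing_inv_mul _ hDt, one_mul]

lemma trace_inv_mul_mul {D : Matrix ι ι ℝ} (hD : IsUnit D.det) (A : Matrix ι ι ℝ) :
    trace (D⁻¹ * A * D) = trace A := by
  rw [trace_mul_comm, ← mul_assoc, mul_nonsing_inv _ hD, one_mul]

lemma trace_inv_mul_congr {D : Matrix ι ι ℝ} (hD : IsUnit D.det) (S β : Matrix ι ι ℝ) :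
    trace ((Dᵀ * S * D)⁻¹ * (Dᵀ * β * D)) = trace (S⁻¹ * β) := by
  rw [inv_mul_congr hD, trace_inv_mul_mul hD]

/-- The pairing is invariant under a linear change of coordinates. -/
lemma pairing_congr {D : Matrix ι ι ℝ} (hD : IsUnit D.det) (S ξ β : Matrix ι ι ℝ) :
    pairing (Dᵀ * S * D) (Dᵀ * ξ * D) (Dᵀ * β * D) = pairing S ξ β := by
  have h : D⁻¹ * (S⁻¹ * ξ) * D * (D⁻¹ * (S⁻¹ * β) * D) = D⁻¹ * (S⁻¹ * ξ * S⁻¹ * β) * D := by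
    simp only [mul_assoc]
    rw [← mul_assoc D, mul_nonsing_inv _ hD, one_mul]
  rw [pairing, mul_assoc (_ * _), inv_mul_congr hD, inv_mul_congr hD, h, trace_inv_mul_mul hD,
    pairing]

lemma pairing_add_left (S ξ ζ β : Matrix ι ι ℝ) :
    pairing S (ξ + ζ) β = pairing S ξ β + pairing S ζ β := by
  simp [pairing, mul_add, add_mul]

lemma pairing_zero_left (S β : Matrix ι ι ℝ) : pairing S 0 β = 0 := by
  simp [pairing]

end MatrixAlgebra

/-! ### Derivatives of inverses, determinants and the volume density -/

section MatrixCalculus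

open Matrix

variable {ι : Type*} {E : Type*} [NormedAddCommGroup E] [NormedSpace ℝ E]

/-- Entrywise derivative of a matrix-valued function in a direction. -/
noncomputable def matDeriv (A : E → Matrix ι ι ℝ) (u v : E) : Matrix ι ι ℝ :=
  of fun i j ↦ fderiv ℝ (fun w ↦ A w i j) u v

variable {A B : E → Matrix ι ι ℝ} {u v : E} {s : Set E}

lemma matDeriv_transpose (hA : ∀ᶠ w in 𝓝 u, (A w)ᵀ = -A w) :
    (matDeriv A u v)ᵀ = -matDeriv A u v := by
  ext i j
  have : (fun w ↦ A w j i) =ᶠ[𝓝 u] fun w ↦ -A w i j := by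
    filter_upwards [hA] with w hw
    exact congrFun (congrFun hw i) j
  simp only [matDeriv, transpose_apply, of_apply, Matrix.neg_apply]
  rw [this.fderiv_eq, fderiv_fun_neg]; rfl

variable [Fintype ι]

lemma contDiffOn_mul_entry (hA : ∀ i j, ContDiffOn ℝ ∞ (fun w ↦ A w i j) s)
    (hB : ∀ i j, ContDiffOn ℝ ∞ (fun w ↦ B w i j) s) (i j : ι) :
    ContDiffOn ℝ ∞ (fun w ↦ (A w * B w) i j) s := by
  simp only [mul_apply]
  exact ContDiffOn.sum fun k _ ↦ (hA i k).mul (hB k j)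

lemma contDiffOn_trace (hA : ∀ i j, ContDiffOn ℝ ∞ (fun w ↦ A w i j) s) :
    ContDiffOn ℝ ∞ (fun w ↦ trace (A w)) s :=
  ContDiffOn.sum fun i _ ↦ hA i i

lemma differentiableAt_mul_entry (hA : ∀ i j, DifferentiableAt ℝ (fun w ↦ A w i j) u)
    (hB : ∀ i j, DifferentiableAt ℝ (fun w ↦ B w i j) u) (i j : ι) :
    DifferentiableAt ℝ (fun w ↦ (A w * B w) i j) u := by
  simp only [mul_apply]
  exact DifferentiableAt.fun_sum fun k _ ↦ (hA i k).mul (hB k j)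

lemma matDeriv_mul (hA : ∀ i j, DifferentiableAt ℝ (fun w ↦ A w i j) u)
    (hB : ∀ i j, DifferentiableAt ℝ (fun w ↦ B w i j) u) :
    matDeriv (fun w ↦ A w * B w) u v = matDeriv A u v * B u + A u * matDeriv B u v := by
  ext i j
  simp only [matDeriv, of_apply, Matrix.add_apply, mul_apply]
  rw [fderiv_fun_sum (A := fun k w ↦ A w i k * B w k j) fun k _ ↦ (hA i k).fun_mul (hB k j),
    _root_.sum_apply, ← Finset.sum_add_distrib]
  refine Finset.sum_congr rfl fun k _ ↦ ?_
  rw [fderiv_fun_mul (hA i k) (hB k j)]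
  simp only [_root_.add_apply, _root_.smul_apply, smul_eq_mul]
  ring

lemma fderiv_trace (hA : ∀ i j, DifferentiableAt ℝ (fun w ↦ A w i j) u) :
    fderiv ℝ (fun w ↦ trace (A w)) u v = trace (matDeriv A u v) := by
  simp only [trace, diag_apply, matDeriv, of_apply]
  rw [fderiv_fun_sum fun i _ ↦ hA i i, _root_.sum_apply]

variable [DecidableEq ι]

lemma contDiffOn_det (hA : ∀ i j, ContDiffOn ℝ ∞ (fun w ↦ A w i j) s) :
    ContDiffOn ℝ ∞ (fun w ↦ (A w).det) s := by
  simp only [det_apply']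
  exact ContDiffOn.sum fun τ _ ↦ contDiffOn_const.mul (contDiffOn_prod fun i _ ↦ hA _ _)

lemma contDiffOn_inv_entry (hA : ∀ i j, ContDiffOn ℝ ∞ (fun w ↦ A w i j) s)
    (hd : ∀ w ∈ s, (A w).det ≠ 0) (i j : ι) :
    ContDiffOn ℝ ∞ (fun w ↦ (A w)⁻¹ i j) s := by
  -- Entries of the adjugate are determinants with one row replaced by a basis vector.
  have h : ContDiffOn ℝ ∞ (fun w ↦ ((A w).updateRow j (Pi.single i 1)).det) s := by
    refine contDiffOn_det fun k l ↦ ?_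
    by_cases hk : k = j
    · subst hk; simp only [updateRow_self]; exact contDiffOn_const
    · simp only [updateRow_ne hk]; exact hA k l
  simp only [inv_def, Matrix.smul_apply, adjugate_apply, Ring.inverse_eq_inv', smul_eq_mul]
  exact ((contDiffOn_det hA).inv hd).mul h

/-- Jacobi's formula. -/
lemma fderiv_det (hA : ∀ i j, DifferentiableAt ℝ (fun w ↦ A w i j) u) :
    fderiv ℝ (fun w ↦ (A w).det) u v = trace ((A u).adjugate * matDeriv A u v) := by
  have hprod : ∀ τ : Equiv.Perm ι, HasFDerivAt (fun w ↦ ∏ i, A w (τ i) i)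
      (∑ i, (∏ j ∈ Finset.univ.erase i, A u (τ j) j) • fderiv ℝ (fun w ↦ A w (τ i) i) u) u :=
    fun τ ↦ HasFDerivAt.finsetProd fun i _ ↦ (hA (τ i) i).hasFDerivAt
  have hdet : HasFDerivAt (fun w ↦ (A w).det) (∑ τ : Equiv.Perm ι,
      ((Equiv.Perm.sign τ : ℤ) : ℝ) • ∑ i, (∏ j ∈ Finset.univ.erase i, A u (τ j) j) •
        fderiv ℝ (fun w ↦ A w (τ i) i) u) u := by
    simp only [det_apply']
    exact HasFDerivAt.fun_sum fun τ _ ↦ (hprod τ).const_mul ((Equiv.Perm.sign τ : ℤ) : ℝ)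
  rw [hdet.fderiv]
  -- By Cramer's rule this diagonal entry is the determinant of `A` with column `i` replaced by its
  -- derivative, so the Leibniz rule sums to the trace.
  have hcol : ∀ i, (A u).adjugate.mulVec (fun k ↦ matDeriv A u v k i) i =
      ∑ τ : Equiv.Perm ι, ((Equiv.Perm.sign τ : ℤ) : ℝ) *
        ((∏ j ∈ Finset.univ.erase i, A u (τ j) j) * matDeriv A u v (τ i) i) := by
    intro i
    rw [← cramer_eq_adjugate_mulVec, cramer_apply, det_apply']
    refine Finset.sum_congr rfl fun τ _ ↦ ?_
    rw [← Finset.prod_erase_mul _ _ (Finset.mem_univ i), updateCol_self]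
    congr 2
    exact Finset.prod_congr rfl fun j hj ↦ by rw [updateCol_ne (Finset.ne_of_mem_erase hj)]
  have htr : trace ((A u).adjugate * matDeriv A u v) =
      ∑ i, (A u).adjugate.mulVec (fun k ↦ matDeriv A u v k i) i := rfl
  rw [htr, Finset.sum_congr rfl fun i _ ↦ hcol i, Finset.sum_comm]
  simp only [_root_.sum_apply, _root_.smul_apply, smul_eq_mul,
    Finset.mul_sum, matDeriv, of_apply]

/-- Obtained by differentiating `A⁻¹ A = 1`, which holds on a neighbourhood of `u`. -/
lemma matDeriv_inv (hA : ∀ i j, DifferentiableAt ℝ (fun w ↦ A w i j) u)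
    (hB : ∀ i j, DifferentiableAt ℝ (fun w ↦ (A w)⁻¹ i j) u)
    (hd : ∀ᶠ w in 𝓝 u, (A w).det ≠ 0) :
    matDeriv (fun w ↦ (A w)⁻¹) u v = -((A u)⁻¹ * matDeriv A u v * (A u)⁻¹) := by
  have h1 : matDeriv (fun w ↦ (A w)⁻¹ * A w) u v = 0 := by
    ext i j
    have : (fun w ↦ ((A w)⁻¹ * A w) i j) =ᶠ[𝓝 u] fun _ ↦ (1 : Matrix ι ι ℝ) i j := by
      filter_upwards [hd] with w hw
      rw [nonsing_inv_mul _ (isUnit_iff_ne_zero.2 hw)]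
    simp only [matDeriv, of_apply]
    rw [this.fderiv_eq]; simp
  rw [matDeriv_mul hB hA] at h1
  have h2 := congrArg (· * (A u)⁻¹) (eq_neg_of_add_eq_zero_left h1)
  simpa only [mul_assoc, mul_nonsing_inv _ (isUnit_iff_ne_zero.2 hd.self_of_nhds), mul_one,
    neg_mul] using h2

/-- The volume density `|det S| ^ (1 / 2)` of a symplectic form with matrix `S`. -/
noncomputable def density (S : Matrix ι ι ℝ) : ℝ := Real.exp (1 / 2 * Real.log S.det)

/-- No nondegeneracy is needed, since the density is an exponential; this gives sign control even at
points outside a chart's target. -/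
lemma density_pos (S : Matrix ι ι ℝ) : 0 < density S := Real.exp_pos _

/-- The determinant changes by `(det D)²`, and the square root is `|det D|` because `Real.log`
ignores signs. This is the Jacobian factor of the change of variables formula. -/
lemma density_congr {D S : Matrix ι ι ℝ} (hD : D.det ≠ 0) (hS : S.det ≠ 0) :
    density (Dᵀ * S * D) = |D.det| * density S := by
  have : (Dᵀ * S * D).det = D.det ^ 2 * S.det := by
    rw [det_mul, det_mul, det_transpose]; ring
  rw [density, this, Real.log_mul (pow_ne_zero _ hD) hS, Real.log_pow, mul_add, Real.exp_add,
    density]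
  congr 1
  rw [← Real.exp_log (abs_pos.2 hD), Real.log_abs]
  congr 1; push_cast; ring

lemma contDiffOn_density (hA : ∀ i j, ContDiffOn ℝ ∞ (fun w ↦ A w i j) s)
    (hd : ∀ w ∈ s, (A w).det ≠ 0) : ContDiffOn ℝ ∞ (fun w ↦ density (A w)) s :=
  (contDiffOn_const.mul ((contDiffOn_det hA).log hd)).exp

lemma fderiv_density (hA : ∀ i j, DifferentiableAt ℝ (fun w ↦ A w i j) u)
    (hdet : DifferentiableAt ℝ (fun w ↦ (A w).det) u) (hd : (A u).det ≠ 0) :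
    fderiv ℝ (fun w ↦ density (A w)) u v =
      density (A u) * (1 / 2 * trace ((A u)⁻¹ * matDeriv A u v)) := by
  have h := ((hdet.hasFDerivAt.log hd).const_mul (1 / 2 : ℝ)).exp
  change fderiv ℝ (fun w ↦ Real.exp (1 / 2 * Real.log (A w).det)) u v = _
  rw [h.fderiv]
  simp only [_root_.smul_apply, smul_eq_mul, fderiv_det hA, density, inv_def,
    Ring.inverse_eq_inv', smul_mul_assoc, trace_smul]

lemma contDiffOn_pairing {S ξ β : E → Matrix ι ι ℝ}
    (hS : ∀ i j, ContDiffOn ℝ ∞ (fun w ↦ S w i j) s) (hd : ∀ w ∈ s, (S w).det ≠ 0)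
    (hξ : ∀ i j, ContDiffOn ℝ ∞ (fun w ↦ ξ w i j) s)
    (hβ : ∀ i j, ContDiffOn ℝ ∞ (fun w ↦ β w i j) s) :
    ContDiffOn ℝ ∞ (fun w ↦ pairing (S w) (ξ w) (β w)) s :=
  contDiffOn_trace (contDiffOn_mul_entry (contDiffOn_mul_entry
    (contDiffOn_mul_entry (contDiffOn_inv_entry hS hd) hξ) (contDiffOn_inv_entry hS hd)) hβ)

end MatrixCalculus

/-! ### Divergence theorem on an open subset of a vector space -/

section Divergence

open MeasureTheory

variable {E : Type*} [NormedAddCommGroup E]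

lemma integrableOn_of_vanish_off_compact [MeasurableSpace E] [BorelSpace E]
    {μ : Measure E} [IsFiniteMeasureOnCompacts μ] {U K : Set E} {f : E → ℝ}
    (hU : IsOpen U) (hK : IsCompact K) (hKU : K ⊆ U) (hf : ContinuousOn f U)
    (h0 : ∀ u ∈ U, u ∉ K → f u = 0) : IntegrableOn f U μ :=
  ((hf.mono hKU).integrableOn_compact hK).of_forall_sdiff_eq_zero hU.measurableSet
    fun u hu ↦ h0 u hu.1 hu.2

variable [NormedSpace ℝ E]

lemma fderiv_eq_zero_of_vanish_off_compact {U K : Set E} {V : E → ℝ}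
    (hU : IsOpen U) (hK : IsCompact K) (h0 : ∀ u ∈ U, u ∉ K → V u = 0) {u : E} (hu : u ∈ U)
    (huK : u ∉ K) : fderiv ℝ V u = 0 := by
  have : V =ᶠ[𝓝 u] fun _ ↦ 0 := by
    filter_upwards [hU.mem_nhds hu, hK.isClosed.isOpen_compl.mem_nhds huK] with w hw hwK
    exact h0 w hw hwK
  rw [this.fderiv_eq, fderiv_const_apply]

variable [FiniteDimensional ℝ E] [MeasurableSpace E] [BorelSpace E] {μ : Measure E}
  [μ.IsAddHaarMeasure]

/-- The divergence theorem for compactly supported functions on an open set. -/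
lemma setIntegral_fderiv_eq_zero {U K : Set E} {V : E → ℝ} (hU : IsOpen U) (hK : IsCompact K)
    (hKU : K ⊆ U) (hV : ContDiffOn ℝ ∞ V U) (h0 : ∀ u ∈ U, u ∉ K → V u = 0) (v : E) :
    ∫ u in U, fderiv ℝ V u v ∂μ = 0 := by
  -- `V` is uncontrolled outside `U`; its extension by zero is smooth everywhere because it vanishes
  -- off the compact set `K ⊆ U`.
  set W := U.indicator V with hW
  have hWK : ∀ u ∉ K, W u = 0 := by
    intro u hu
    by_cases hu' : u ∈ U
    · rw [hW, Set.indicator_of_mem hu', h0 u hu' hu]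
    · rw [hW, Set.indicator_of_notMem hu']
  have hVW : ∀ u ∈ U, W =ᶠ[𝓝 u] V := fun u hu ↦ by
    filter_upwards [hU.mem_nhds hu] with w hw using Set.indicator_of_mem hw V
  have hWd : ContDiff ℝ ∞ W := by
    rw [contDiff_iff_contDiffAt]
    intro u
    by_cases hu : u ∈ K
    · exact (hV.contDiffAt (hU.mem_nhds (hKU hu))).congr_of_eventuallyEq (hVW u (hKU hu))
    · refine (contDiffAt_const (c := (0 : ℝ))).congr_of_eventuallyEq ?_
      filter_upwards [hK.isClosed.isOpen_compl.mem_nhds hu] with w hw using hWK w hw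
  have hWc : HasCompactSupport W := HasCompactSupport.intro hK fun u hu ↦ hWK u hu
  have hc' : Continuous fun u ↦ fderiv ℝ W u v :=
    (hWd.continuous_fderiv (by simp)).clm_apply continuous_const
  have hi' : Integrable (fun u ↦ fderiv ℝ W u v) μ :=
    hc'.integrable_of_hasCompactSupport (hWc.fderiv_apply ℝ v)
  have hint : ∫ u, fderiv ℝ W u v ∂μ = 0 := by
    have hz : Integrable (fun u ↦ fderiv ℝ (fun _ : E ↦ (1 : ℝ)) u v * W u) μ := by
      simp only [fderiv_const_apply, _root_.zero_apply, zero_mul]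
      exact integrable_zero _ _ _
    -- Integration by parts against the constant function `1`.
    have := integral_mul_fderiv_eq_neg_fderiv_mul_of_integrable (𝕜 := ℝ) (μ := μ)
      (f := fun _ : E ↦ (1 : ℝ)) (g := W) (v := v) hz (by simpa using hi')
      (by simpa using hWd.continuous.integrable_of_hasCompactSupport hWc)
      (fun _ _ ↦ differentiableAt_const _)
      (fun u _ ↦ hWd.differentiable (by simp) u)
    simpa using this
  rw [← hint, ← setIntegral_eq_integral_of_forall_compl_eq_zero (s := U)
    (f := fun u ↦ fderiv ℝ W u v)]
  · refine setIntegral_congr_fun hU.measurableSet fun u hu ↦ ?_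
    rw [(hVW u hu).fderiv_eq]
  · intro u hu
    rw [fderiv_eq_zero_of_vanish_off_compact (U := Set.univ) isOpen_univ hK
      (fun w _ ↦ hWK w) trivial fun h ↦ hu (hKU h)]
    rfl

end Divergence

/-! ### Matrices of 2-forms on Euclidean space -/

section FormMatrix

open Matrix

variable {m : ℕ}

/-- Euclidean space of dimension `m`. -/
abbrev Euc (m : ℕ) : Type := EuclideanSpace ℝ (Fin m)

/-- The standard basis of `ℝ^m`. -/
noncomputable abbrev stdBasis (m : ℕ) : Module.Basis (Fin m) ℝ (Euc m) :=
  (EuclideanSpace.basisFun (Fin m) ℝ).toBasis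

/-- A 2-form on a vector space as a bilinear form. -/
noncomputable def formBilin (θ : (Euc m) [⋀^Fin 2]→L[ℝ] ℝ) : (Euc m) →ₗ[ℝ] (Euc m) →ₗ[ℝ] ℝ :=
  LinearMap.mk₂ ℝ (fun x y ↦ θ ![x, y])
    (fun x x' y ↦ θ.map_vecCons_add ![y] x x') (fun c x y ↦ θ.map_vecCons_smul ![y] c x)
    (fun x y y' ↦ by
      have h := (θ.toAlternatingMap.curryLeft x).map_vecCons_add ![] y y'
      exact h)
    (fun c x y ↦ by
      have h := (θ.toAlternatingMap.curryLeft x).map_vecCons_smul ![] c y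
      exact h)

/-- The matrix of a 2-form in the standard basis. -/
noncomputable def formMatrix (θ : (Euc m) [⋀^Fin 2]→L[ℝ] ℝ) : Matrix (Fin m) (Fin m) ℝ :=
  of fun i j ↦ θ ![stdBasis m i, stdBasis m j]

/-- The matrix of an endomorphism in the standard basis. -/
noncomputable def endMatrix (D : (Euc m) →L[ℝ] (Euc m)) : Matrix (Fin m) (Fin m) ℝ :=
  LinearMap.toMatrix (stdBasis m) (stdBasis m) D

lemma formMatrix_eq (θ : (Euc m) [⋀^Fin 2]→L[ℝ] ℝ) :
    formMatrix θ = LinearMap.toMatrix₂ (stdBasis m) (stdBasis m) (formBilin θ) := by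
  ext i j
  rw [LinearMap.toMatrix₂_apply]; rfl

lemma formMatrix_injective {θ θ' : (Euc m) [⋀^Fin 2]→L[ℝ] ℝ} (h : formMatrix θ = formMatrix θ') :
    θ = θ' := by
  rw [formMatrix_eq, formMatrix_eq, EmbeddingLike.apply_eq_iff_eq] at h
  ext v
  have := LinearMap.congr_fun₂ h (v 0) (v 1)
  have hv : v = ![v 0, v 1] := by ext i; fin_cases i <;> rfl
  rw [hv]
  exact this

lemma formMatrix_comp (θ : (Euc m) [⋀^Fin 2]→L[ℝ] ℝ) (D : (Euc m) →L[ℝ] (Euc m)) :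
    formMatrix (θ.compContinuousLinearMap D) = (endMatrix D)ᵀ * formMatrix θ * endMatrix D := by
  rw [formMatrix_eq, formMatrix_eq, endMatrix, ← LinearMap.toMatrix₂_compl₁₂]
  congr 1
  ext x y
  change θ (D ∘ ![x, y]) = θ ![D x, D y]
  congr 1
  ext i; fin_cases i <;> rfl

lemma formMatrix_transpose (θ : (Euc m) [⋀^Fin 2]→L[ℝ] ℝ) : (formMatrix θ)ᵀ = -formMatrix θ := by
  ext i j
  have := θ.map_swap ![stdBasis m i, stdBasis m j] (i := 0) (j := 1) (by simp)
  change θ ![stdBasis m j, stdBasis m i] = -θ ![stdBasis m i, stdBasis m j]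
  refine Eq.trans ?_ this
  change θ _ = θ _
  congr 1
  ext1 k; fin_cases k <;> rfl

lemma formMatrix_add (θ η : (Euc m) [⋀^Fin 2]→L[ℝ] ℝ) :
    formMatrix (θ + η) = formMatrix θ + formMatrix η := rfl

lemma formMatrix_zero : formMatrix (0 : (Euc m) [⋀^Fin 2]→L[ℝ] ℝ) = 0 := rfl

lemma formBilin_eq_dotProduct (θ : (Euc m) [⋀^Fin 2]→L[ℝ] ℝ) (x y : Euc m) :
    θ ![x, y] = x.ofLp ⬝ᵥ formMatrix θ *ᵥ y.ofLp := by
  have h := dotProduct_toMatrix₂_mulVec (σ₁ := RingHom.id ℝ) (σ₂ := RingHom.id ℝ)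
    (b₁ := stdBasis m) (b₂ := stdBasis m) (formBilin θ) x.ofLp y.ofLp
  rw [← formMatrix_eq] at h
  have e : ∀ z : Euc m, (stdBasis m).equivFun.symm z.ofLp = z := by
    intro z
    rw [LinearEquiv.symm_apply_eq]
    ext i; simp [stdBasis]
  rw [e, e] at h
  exact h.symm

lemma endMatrix_mul (D D' : (Euc m) →L[ℝ] (Euc m)) :
    endMatrix (D.comp D') = endMatrix D * endMatrix D' :=
  LinearMap.toMatrix_comp _ _ _ _ _

lemma det_endMatrix (D : (Euc m) →L[ℝ] (Euc m)) : (endMatrix D).det = D.det :=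
  LinearMap.det_toMatrix _ _

lemma endMatrix_mulVec (D : (Euc m) →L[ℝ] (Euc m)) (x : Euc m) :
    endMatrix D *ᵥ x.ofLp = (D x).ofLp := by
  have h := LinearMap.toMatrix_mulVec_repr (stdBasis m) (stdBasis m) (D : (Euc m) →ₗ[ℝ] (Euc m)) x
  exact h

lemma det_formMatrix_ne_zero {θ : (Euc m) [⋀^Fin 2]→L[ℝ] ℝ}
    (h : ∀ u, (∀ v, θ ![u, v] = 0) → u = 0) : (formMatrix θ).det ≠ 0 := by
  intro h0
  obtain ⟨x, hx, hx0⟩ := Matrix.exists_vecMul_eq_zero_iff.2 h0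
  refine hx ?_
  have := h (WithLp.toLp 2 x) fun v ↦ by
    rw [formBilin_eq_dotProduct, dotProduct_mulVec, hx0, zero_dotProduct]
  exact congrArg WithLp.ofLp this

section Calculus

variable {k : ℕ} {U : Set (Euc m)}

lemma extDeriv_one_apply {γ : (Euc m) → (Euc m) [⋀^Fin 1]→L[ℝ] ℝ} {u : Euc m}
    (h : DifferentiableAt ℝ γ u) (a b : Euc m) :
    extDeriv γ u ![a, b] =
      fderiv ℝ (fun w ↦ γ w ![b]) u a - fderiv ℝ (fun w ↦ γ w ![a]) u b := by
  have e0 : (0 : Fin 2).removeNth ![a, b] = ![b] := by ext i; fin_cases i; rfl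
  have e1 : (1 : Fin 2).removeNth ![a, b] = ![a] := by ext i; fin_cases i; rfl
  rw [extDeriv_apply h, Fin.sum_univ_two, e0, e1]
  simp [sub_eq_add_neg]

lemma extDeriv_two_apply {θ : (Euc m) → (Euc m) [⋀^Fin 2]→L[ℝ] ℝ} {u : Euc m}
    (h : DifferentiableAt ℝ θ u) (a b c : Euc m) :
    extDeriv θ u ![a, b, c] = fderiv ℝ (fun w ↦ θ w ![b, c]) u a -
      fderiv ℝ (fun w ↦ θ w ![a, c]) u b + fderiv ℝ (fun w ↦ θ w ![a, b]) u c := by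
  have e0 : (0 : Fin 3).removeNth ![a, b, c] = ![b, c] := by ext i; fin_cases i <;> rfl
  have e1 : (1 : Fin 3).removeNth ![a, b, c] = ![a, c] := by ext i; fin_cases i <;> rfl
  have e2 : (2 : Fin 3).removeNth ![a, b, c] = ![a, b] := by ext i; fin_cases i <;> rfl
  rw [extDeriv_apply h, Fin.sum_univ_three, e0, e1, e2]
  simp [sub_eq_add_neg]

lemma contDiffOn_form_apply {γ : (Euc m) → (Euc m) [⋀^Fin k]→L[ℝ] ℝ} (h : ContDiffOn ℝ ∞ γ U)
    (v : Fin k → Euc m) : ContDiffOn ℝ ∞ (fun w ↦ γ w v) U :=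
  (ContinuousAlternatingMap.apply ℝ (Euc m) ℝ v).contDiff.comp_contDiffOn h

lemma contDiffOn_formMatrix {θ : (Euc m) → (Euc m) [⋀^Fin 2]→L[ℝ] ℝ} (h : ContDiffOn ℝ ∞ θ U)
    (i j : Fin m) : ContDiffOn ℝ ∞ (fun w ↦ formMatrix (θ w) i j) U :=
  contDiffOn_form_apply h _

/-- This is `dθ = 0` on three basis vectors; skewness absorbs the minus sign of the middle term and
gives the cyclic form used in the algebraic identities. -/
lemma matDeriv_cyclic {θ : (Euc m) → (Euc m) [⋀^Fin 2]→L[ℝ] ℝ} {u : Euc m}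
    (h : DifferentiableAt ℝ θ u) (hd : extDeriv θ u = 0) (i a b : Fin m) :
    matDeriv (fun w ↦ formMatrix (θ w)) u (stdBasis m i) a b +
      matDeriv (fun w ↦ formMatrix (θ w)) u (stdBasis m a) b i +
      matDeriv (fun w ↦ formMatrix (θ w)) u (stdBasis m b) i a = 0 := by
  have h1 := extDeriv_two_apply h (stdBasis m i) (stdBasis m a) (stdBasis m b)
  have h2 := matDeriv_transpose (A := fun w ↦ formMatrix (θ w)) (u := u) (v := stdBasis m a)
    (Filter.Eventually.of_forall fun w ↦ formMatrix_transpose (θ w))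
  have h3 : matDeriv (fun w ↦ formMatrix (θ w)) u (stdBasis m a) b i =
    -matDeriv (fun w ↦ formMatrix (θ w)) u (stdBasis m a) i b := congrFun (congrFun h2 i) b
  rw [hd] at h1
  rw [h3]
  exact (by simpa [sub_eq_add_neg] using h1.symm :
    fderiv ℝ (fun w ↦ θ w ![stdBasis m a, stdBasis m b]) u (stdBasis m i) +
      -fderiv ℝ (fun w ↦ θ w ![stdBasis m i, stdBasis m b]) u (stdBasis m a) +
      fderiv ℝ (fun w ↦ θ w ![stdBasis m i, stdBasis m a]) u (stdBasis m b) = 0)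

end Calculus

end FormMatrix

/-! ### Co-closedness and integration by parts in a domain -/

section LocalDivergence

open Matrix MeasureTheory

variable {m : ℕ} {U : Set (Euc m)} {θ η : Euc m → (Euc m) [⋀^Fin 2]→L[ℝ] ℝ}

/-- The coefficients of the bivector density dual to a 2-form `η` with respect to a symplectic
form `θ`. -/
noncomputable def dualDensity (θ η : (Euc m) [⋀^Fin 2]→L[ℝ] ℝ) (i j : Fin m) : ℝ :=
  density (formMatrix θ) * ((formMatrix θ)⁻¹ * formMatrix η * (formMatrix θ)⁻¹) i j

lemma contDiffOn_dualDensity (hθ : ContDiffOn ℝ ∞ θ U) (hη : ContDiffOn ℝ ∞ η U)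
    (hd : ∀ u ∈ U, (formMatrix (θ u)).det ≠ 0) (i j : Fin m) :
    ContDiffOn ℝ ∞ (fun u ↦ dualDensity (θ u) (η u) i j) U :=
  (contDiffOn_density (contDiffOn_formMatrix hθ) hd).mul (contDiffOn_mul_entry
    (contDiffOn_mul_entry (contDiffOn_inv_entry (contDiffOn_formMatrix hθ) hd)
      (contDiffOn_formMatrix hη)) (contDiffOn_inv_entry (contDiffOn_formMatrix hθ) hd) i j)

lemma inv_formMatrix_transpose {θ : (Euc m) [⋀^Fin 2]→L[ℝ] ℝ} (h : (formMatrix θ).det ≠ 0) :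
    ((formMatrix θ)⁻¹)ᵀ = -(formMatrix θ)⁻¹ := by
  rw [transpose_nonsing_inv, formMatrix_transpose]
  refine inv_eq_right_inv ?_
  rw [neg_mul_neg, mul_nonsing_inv _ (isUnit_iff_ne_zero.2 h)]

/-- A closed primitive 2-form on a symplectic domain is co-closed. -/
lemma sum_fderiv_dualDensity (hU : IsOpen U) (hθ : ContDiffOn ℝ ∞ θ U) (hη : ContDiffOn ℝ ∞ η U)
    (hd : ∀ u ∈ U, (formMatrix (θ u)).det ≠ 0)
    (cθ : ∀ u ∈ U, extDeriv θ u = 0) (cη : ∀ u ∈ U, extDeriv η u = 0)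
    (htr : ∀ u ∈ U, trace ((formMatrix (θ u))⁻¹ * formMatrix (η u)) = 0)
    {u : Euc m} (hu : u ∈ U) (j : Fin m) :
    ∑ i, fderiv ℝ (fun w ↦ dualDensity (θ w) (η w) i j) u (stdBasis m i) = 0 := by
  have hUu : U ∈ 𝓝 u := hU.mem_nhds hu
  have diff : ∀ {f : Euc m → ℝ}, ContDiffOn ℝ ∞ f U → DifferentiableAt ℝ f u := fun h ↦
    (h.contDiffAt hUu).differentiableAt (by simp)
  have hS := contDiffOn_formMatrix hθ
  have hβ := contDiffOn_formMatrix hη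
  have hP := contDiffOn_inv_entry hS hd
  have dS : ∀ i j, DifferentiableAt ℝ (fun w ↦ formMatrix (θ w) i j) u := fun i j ↦ diff (hS i j)
  have dβ : ∀ i j, DifferentiableAt ℝ (fun w ↦ formMatrix (η w) i j) u := fun i j ↦ diff (hβ i j)
  have dP : ∀ i j, DifferentiableAt ℝ (fun w ↦ (formMatrix (θ w))⁻¹ i j) u :=
    fun i j ↦ diff (hP i j)
  have dPβ := differentiableAt_mul_entry dP dβ
  have dB := differentiableAt_mul_entry dPβ dP
  have hdev : ∀ᶠ w in 𝓝 u, (formMatrix (θ w)).det ≠ 0 := by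
    filter_upwards [hUu] with w hw using hd w hw
  have hθu : DifferentiableAt ℝ θ u := (hθ.contDiffAt hUu).differentiableAt (by simp)
  have hηu : DifferentiableAt ℝ η u := (hη.contDiffAt hUu).differentiableAt (by simp)
  have key := sum_divergence_eq_zero (P := (formMatrix (θ u))⁻¹) (β := formMatrix (η u))
    (dS := fun k ↦ matDeriv (fun w ↦ formMatrix (θ w)) u (stdBasis m k))
    (dβ := fun k ↦ matDeriv (fun w ↦ formMatrix (η w)) u (stdBasis m k))
    (dP := fun k ↦ matDeriv (fun w ↦ (formMatrix (θ w))⁻¹) u (stdBasis m k))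
    (inv_formMatrix_transpose (hd u hu)) (formMatrix_transpose _)
    (fun k ↦ matDeriv_inv dS dP hdev)
    (fun k ↦ matDeriv_transpose (.of_forall fun w ↦ formMatrix_transpose _))
    (fun k ↦ matDeriv_transpose (.of_forall fun w ↦ formMatrix_transpose _))
    (matDeriv_cyclic hθu (cθ u hu)) (matDeriv_cyclic hηu (cη u hu))
    -- Primitivity holds on all of `U`, so it may be differentiated.
    (fun k ↦ by
      rw [← matDeriv_mul dP dβ, ← fderiv_trace dPβ]
      have : (fun w ↦ trace ((formMatrix (θ w))⁻¹ * formMatrix (η w))) =ᶠ[𝓝 u] fun _ ↦ 0 := by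
        filter_upwards [hUu] with w hw using htr w hw
      rw [this.fderiv_eq, fderiv_const_apply]; rfl) j
  rw [← mul_zero (density (formMatrix (θ u))), ← key, Finset.mul_sum]
  refine Finset.sum_congr rfl fun i _ ↦ ?_
  have e1 : fderiv ℝ (fun w ↦ ((formMatrix (θ w))⁻¹ * formMatrix (η w) * (formMatrix (θ w))⁻¹) i j)
      u (stdBasis m i) = matDeriv (fun w ↦ (formMatrix (θ w))⁻¹ * formMatrix (η w) *
        (formMatrix (θ w))⁻¹) u (stdBasis m i) i j := rfl
  simp only [dualDensity]
  rw [fderiv_fun_mul (diff (contDiffOn_density hS hd)) (dB i j), _root_.add_apply,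
    _root_.smul_apply, _root_.smul_apply, e1, matDeriv_mul dPβ dP, matDeriv_mul dP dβ,
    fderiv_density dS (diff (contDiffOn_det hS)) (hd u hu), add_mul]
  simp only [smul_eq_mul]
  ring

/-- With `(dγ)_ij = ∂_i γ_j - ∂_j γ_i` and `B` skew, the two halves of `tr (dγ B)` agree; the sign
in `-2` comes from `B_ji = -B_ij`. -/
lemma pairing_extDeriv {θ η : (Euc m) [⋀^Fin 2]→L[ℝ] ℝ} {γ : Euc m → (Euc m) [⋀^Fin 1]→L[ℝ] ℝ}
    {u : Euc m} (hγ : DifferentiableAt ℝ γ u) (hd : (formMatrix θ).det ≠ 0) :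
    pairing (formMatrix θ) (formMatrix (extDeriv γ u)) (formMatrix η) * density (formMatrix θ) =
      -2 * ∑ i, ∑ j, fderiv ℝ (fun w ↦ γ w ![stdBasis m j]) u (stdBasis m i) *
        dualDensity θ η i j := by
  set B := (formMatrix θ)⁻¹ * formMatrix η * (formMatrix θ)⁻¹ with hB
  have hBt : ∀ i j, B j i = -B i j := by
    have : Bᵀ = -B := by
      simp [hB, transpose_mul, inv_formMatrix_transpose hd, formMatrix_transpose, mul_assoc]
    exact fun i j ↦ congrFun (congrFun this i) j
  have h1 : pairing (formMatrix θ) (formMatrix (extDeriv γ u)) (formMatrix η) =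
      trace (formMatrix (extDeriv γ u) * B) := by
    rw [pairing, mul_assoc, mul_assoc, trace_mul_comm, mul_assoc]
  set g : Fin m → Fin m → ℝ := fun i j ↦ fderiv ℝ (fun w ↦ γ w ![stdBasis m j]) u (stdBasis m i)
  have h2 : ∀ i j, formMatrix (extDeriv γ u) i j = g i j - g j i := fun i j ↦
    extDeriv_one_apply hγ _ _
  have h3 : trace (formMatrix (extDeriv γ u) * B) = -2 * ∑ i, ∑ j, g i j * B i j := by
    simp only [trace, diag_apply, mul_apply, h2, sub_mul, Finset.sum_sub_distrib]
    rw [Finset.sum_comm (f := fun i j ↦ g j i * B j i)]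
    have : ∑ i, ∑ j, g i j * B j i = -∑ i, ∑ j, g i j * B i j := by
      rw [← Finset.sum_neg_distrib]
      refine Finset.sum_congr rfl fun i _ ↦ ?_
      rw [← Finset.sum_neg_distrib]
      refine Finset.sum_congr rfl fun j _ ↦ ?_
      rw [hBt i j]; ring
    rw [this]; ring
  rw [h1, h3, mul_assoc, Finset.sum_mul]
  congr 1
  refine Finset.sum_congr rfl fun i _ ↦ ?_
  rw [Finset.sum_mul]
  refine Finset.sum_congr rfl fun j _ ↦ ?_
  simp only [dualDensity, g, hB]; ring

/-- Integration by parts against a closed primitive 2-form in a symplectic domain. -/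
theorem setIntegral_pairing_extDeriv_eq_zero (hU : IsOpen U) (hθ : ContDiffOn ℝ ∞ θ U)
    (hη : ContDiffOn ℝ ∞ η U) (hd : ∀ u ∈ U, (formMatrix (θ u)).det ≠ 0)
    (cθ : ∀ u ∈ U, extDeriv θ u = 0) (cη : ∀ u ∈ U, extDeriv η u = 0)
    (htr : ∀ u ∈ U, trace ((formMatrix (θ u))⁻¹ * formMatrix (η u)) = 0)
    {γ : Euc m → (Euc m) [⋀^Fin 1]→L[ℝ] ℝ} (hγ : ContDiffOn ℝ ∞ γ U) {K : Set (Euc m)}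
    (hK : IsCompact K) (hKU : K ⊆ U) (h0 : ∀ u ∈ U, u ∉ K → γ u = 0) :
    ∫ u in U, pairing (formMatrix (θ u)) (formMatrix (extDeriv γ u)) (formMatrix (η u)) *
      density (formMatrix (θ u)) = 0 := by
  -- The vector density obtained by contracting `γ` with the bivector density dual to `η`; the
  -- integrand is `-2` times its divergence.
  set V : Fin m → Euc m → ℝ := fun i u ↦
    ∑ j, γ u ![stdBasis m j] * dualDensity (θ u) (η u) i j with hV
  have hVs : ∀ i, ContDiffOn ℝ ∞ (V i) U := fun i ↦ ContDiffOn.sum fun j _ ↦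
    (contDiffOn_form_apply hγ _).mul (contDiffOn_dualDensity hθ hη hd i j)
  have hV0 : ∀ i, ∀ u ∈ U, u ∉ K → V i u = 0 := by
    intro i u hu huK
    simp only [hV, h0 u hu huK]
    simp
  have hpt : ∀ u ∈ U, pairing (formMatrix (θ u)) (formMatrix (extDeriv γ u)) (formMatrix (η u)) *
      density (formMatrix (θ u)) = -2 * ∑ i, fderiv ℝ (V i) u (stdBasis m i) := by
    intro u hu
    have hUu : U ∈ 𝓝 u := hU.mem_nhds hu
    have dγ : ∀ j, DifferentiableAt ℝ (fun w ↦ γ w ![stdBasis m j]) u := fun j ↦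
      ((contDiffOn_form_apply hγ _).contDiffAt hUu).differentiableAt (by simp)
    have dB : ∀ i j, DifferentiableAt ℝ (fun w ↦ dualDensity (θ w) (η w) i j) u := fun i j ↦
      ((contDiffOn_dualDensity hθ hη hd i j).contDiffAt hUu).differentiableAt (by simp)
    rw [pairing_extDeriv ((hγ.contDiffAt hUu).differentiableAt (by simp)) (hd u hu)]
    congr 1
    have h1 : ∀ i, fderiv ℝ (V i) u (stdBasis m i) =
        ∑ j, fderiv ℝ (fun w ↦ γ w ![stdBasis m j]) u (stdBasis m i) * dualDensity (θ u) (η u) i j +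
        ∑ j, γ u ![stdBasis m j] *
          fderiv ℝ (fun w ↦ dualDensity (θ w) (η w) i j) u (stdBasis m i) := by
      intro i
      rw [hV, fderiv_fun_sum (A := fun j w ↦ γ w ![stdBasis m j] * dualDensity (θ w) (η w) i j)
        fun j _ ↦ (dγ j).fun_mul (dB i j), _root_.sum_apply, ← Finset.sum_add_distrib]
      refine Finset.sum_congr rfl fun j _ ↦ ?_
      rw [fderiv_fun_mul (dγ j) (dB i j)]
      simp only [_root_.add_apply, _root_.smul_apply, smul_eq_mul]
      ring
    -- After exchanging sums, the terms that differentiate the dual density vanish by co-closedness.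
    rw [Finset.sum_congr rfl fun i _ ↦ h1 i, Finset.sum_add_distrib,
      Finset.sum_comm (f := fun i j ↦ γ u ![stdBasis m j] * _)]
    simp only [← Finset.mul_sum, sum_fderiv_dualDensity hU hθ hη hd cθ cη htr hu, mul_zero,
      Finset.sum_const_zero, add_zero]
  rw [setIntegral_congr_fun hU.measurableSet hpt, integral_const_mul, integral_finsetSum]
  · simp [setIntegral_fderiv_eq_zero hU hK hKU (hVs _) (hV0 _)]
  · intro i _
    refine integrableOn_of_vanish_off_compact hU hK hKU ?_ ?_
    · exact (((hVs i).fderiv_of_isOpen (m := ∞) hU (by simp)).continuousOn).clm_apply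
        continuousOn_const
    · intro u hu huK
      rw [fderiv_eq_zero_of_vanish_off_compact hU hK (hV0 i) hu huK]; rfl

end LocalDivergence

/-! ### Chart integrals and globalization by a partition of unity -/

section Global

open Matrix MeasureTheory DeRham

variable {m k : ℕ} {M : Type*} [TopologicalSpace M]

lemma notMem_of_notMem_image {e : OpenPartialHomeomorph M (Euc m)} {C : Set M} {u : Euc m}
    (hu : u ∈ e.target) (h : u ∉ e '' C) : e.symm u ∉ C :=
  fun hc ↦ h ⟨_, hc, e.right_inv hu⟩

variable [ChartedSpace (Euc m) M]

/-- Evaluation of smooth forms at a point. -/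
noncomputable def evalAt (x : M) : Form (Euc m) M k →+ ((Euc m) [⋀^Fin k]→L[ℝ] ℝ) :=
  AddMonoidHom.mk' (fun α ↦ α x) fun _ _ ↦ rfl

lemma evalAt_injective {α β : Form (Euc m) M k} (h : ∀ x, evalAt x α = evalAt x β) : α = β :=
  Subtype.ext (funext h)

/-- The pointwise pairing of 2-forms induced by a symplectic form. -/
noncomputable def pairAt (σ β : Form (Euc m) M 2) (x : M) : Form (Euc m) M 2 →+ ℝ :=
  AddMonoidHom.mk'
    (fun ξ ↦ pairing (formMatrix (evalAt x σ)) (formMatrix (evalAt x ξ)) (formMatrix (evalAt x β)))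
    fun ξ ζ ↦ by rw [map_add, formMatrix_add, pairing_add_left]

lemma pairAt_apply (σ β ξ : Form (Euc m) M 2) (x : M) : pairAt σ β x ξ =
    pairing (formMatrix (evalAt x σ)) (formMatrix (evalAt x ξ)) (formMatrix (evalAt x β)) := rfl

/-- The matrix of the derivative of an inverse chart. -/
noncomputable def chartMatrix (e : OpenPartialHomeomorph M (Euc m)) (u : Euc m) :
    Matrix (Fin m) (Fin m) ℝ :=
  endMatrix (mfderiv 𝓘(ℝ, Euc m) 𝓘(ℝ, Euc m) e.symm u)

lemma formMatrix_coordRep (e : OpenPartialHomeomorph M (Euc m)) (α : Form (Euc m) M 2)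
    (u : Euc m) : formMatrix (coordRep e α.1 u) =
      (chartMatrix e u)ᵀ * formMatrix (evalAt (e.symm u) α) * chartMatrix e u :=
  formMatrix_comp _ _

/-- The integral of a function over a chart domain with respect to the symplectic volume. -/
noncomputable def chartIntegral (σ : Form (Euc m) M 2) (e : OpenPartialHomeomorph M (Euc m))
    (F : M → ℝ) : ℝ :=
  ∫ u in e.target, F (e.symm u) * density (formMatrix (coordRep e σ.1 u))

variable {e e' : OpenPartialHomeomorph M (Euc m)}

lemma det_chartMatrix_ne_zero (he : e ∈ IsManifold.maximalAtlas 𝓘(ℝ, Euc m) ∞ M) {u : Euc m}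
    (hu : u ∈ e.target) : (chartMatrix e u).det ≠ 0 := by
  have h1 := mdifferentiableAt_chart he (e.map_target hu)
  have hcomp : mfderiv 𝓘(ℝ, Euc m) 𝓘(ℝ, Euc m) (e ∘ e.symm) u =
      (mfderiv 𝓘(ℝ, Euc m) 𝓘(ℝ, Euc m) e (e.symm u)).comp
        (mfderiv 𝓘(ℝ, Euc m) 𝓘(ℝ, Euc m) e.symm u) :=
    mfderiv_comp u h1 (mdifferentiableAt_chart_symm he hu)
  have hid : (e ∘ e.symm) =ᶠ[𝓝 u] id := by
    filter_upwards [e.open_target.mem_nhds hu] with w hw using e.right_inv hw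
  rw [hid.mfderiv_eq, mfderiv_id] at hcomp
  have h2 := (endMatrix_mul (mfderiv 𝓘(ℝ, Euc m) 𝓘(ℝ, Euc m) e (e.symm u) : Euc m →L[ℝ] Euc m)
    (mfderiv 𝓘(ℝ, Euc m) 𝓘(ℝ, Euc m) e.symm u : Euc m →L[ℝ] Euc m)).symm.trans
    (congrArg (endMatrix (m := m)) hcomp.symm)
  have h3 : endMatrix (ContinuousLinearMap.id ℝ (Euc m)) = 1 := LinearMap.toMatrix_id _
  have h4 := congrArg Matrix.det (h2.trans h3)
  rw [det_mul, det_one] at h4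
  exact right_ne_zero_of_mul_eq_one h4

lemma pairing_coordRep (he : e ∈ IsManifold.maximalAtlas 𝓘(ℝ, Euc m) ∞ M) {u : Euc m}
    (hu : u ∈ e.target) (σ β ξ : Form (Euc m) M 2) :
    pairing (formMatrix (coordRep e σ.1 u)) (formMatrix (coordRep e ξ.1 u))
      (formMatrix (coordRep e β.1 u)) = pairAt σ β (e.symm u) ξ := by
  rw [formMatrix_coordRep, formMatrix_coordRep, formMatrix_coordRep,
    pairing_congr (isUnit_iff_ne_zero.2 (det_chartMatrix_ne_zero he hu)), pairAt_apply]

lemma trace_inv_mul_coordRep (he : e ∈ IsManifold.maximalAtlas 𝓘(ℝ, Euc m) ∞ M) {u : Euc m}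
    (hu : u ∈ e.target) (σ β : Form (Euc m) M 2) :
    trace ((formMatrix (coordRep e σ.1 u))⁻¹ * formMatrix (coordRep e β.1 u)) =
      trace ((formMatrix (evalAt (e.symm u) σ))⁻¹ * formMatrix (evalAt (e.symm u) β)) := by
  rw [formMatrix_coordRep, formMatrix_coordRep]
  exact trace_inv_mul_congr (isUnit_iff_ne_zero.2 (det_chartMatrix_ne_zero he hu)) _ _

lemma det_coordRep_ne_zero {σ : Form (Euc m) M 2}
    (hσ : ∀ x, (formMatrix (evalAt x σ)).det ≠ 0)
    (he : e ∈ IsManifold.maximalAtlas 𝓘(ℝ, Euc m) ∞ M) {u : Euc m}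
    (hu : u ∈ e.target) : (formMatrix (coordRep e σ.1 u)).det ≠ 0 := by
  have := det_chartMatrix_ne_zero he hu
  rw [formMatrix_coordRep, det_mul, det_mul, det_transpose]
  exact mul_ne_zero (mul_ne_zero this (hσ _)) this

/-- Change of charts for the symplectic volume. -/
lemma chartIntegral_congr {σ : Form (Euc m) M 2} (hσ : ∀ x, (formMatrix (evalAt x σ)).det ≠ 0)
    (he : e ∈ IsManifold.maximalAtlas 𝓘(ℝ, Euc m) ∞ M)
    (he' : e' ∈ IsManifold.maximalAtlas 𝓘(ℝ, Euc m) ∞ M) {F : M → ℝ}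
    (hF : ∀ x, x ∉ e.source ∩ e'.source → F x = 0) :
    chartIntegral σ e F = chartIntegral σ e' F := by
  set φ : Euc m → Euc m := fun w ↦ e' (e.symm w) with hφ
  set s : Set (Euc m) := e.target ∩ e.symm ⁻¹' e'.source with hs
  have hso : IsOpen s := e.isOpen_inter_preimage_symm e'.open_source
  have hφd : ∀ u ∈ s, DifferentiableAt ℝ φ u := by
    intro u hu
    rw [← mdifferentiableAt_iff_differentiableAt]
    exact (mdifferentiableAt_chart he' hu.2).comp u (mdifferentiableAt_chart_symm he hu.1)
  have hinj : Set.InjOn φ s := by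
    intro u hu w hw h
    have := e'.injOn hu.2 hw.2 h
    exact e.symm.injOn hu.1 hw.1 this
  have himg : φ '' s = e'.target ∩ e'.symm ⁻¹' e.source := by
    ext w
    constructor
    · rintro ⟨u, hu, rfl⟩
      refine ⟨e'.map_source hu.2, ?_⟩
      rw [Set.mem_preimage, hφ, e'.left_inv hu.2]
      exact e.map_target hu.1
    · rintro ⟨hw, hw'⟩
      refine ⟨e (e'.symm w), ⟨e.map_source hw', ?_⟩, ?_⟩
      · rw [Set.mem_preimage, e.left_inv hw']
        exact e'.map_target hw
      · rw [hφ]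
        simp only [e.left_inv hw', e'.right_inv hw]
  have h1 : chartIntegral σ e F =
      ∫ u in s, F (e.symm u) * density (formMatrix (coordRep e σ.1 u)) := by
    refine setIntegral_eq_of_subset_of_forall_sdiff_eq_zero e.open_target.measurableSet
      Set.inter_subset_left fun u hu ↦ ?_
    rw [hF _ fun h ↦ hu.2 ⟨hu.1, h.2⟩, zero_mul]
  have h2 : chartIntegral σ e' F =
      ∫ u in φ '' s, F (e'.symm u) * density (formMatrix (coordRep e' σ.1 u)) := by
    rw [himg]
    refine setIntegral_eq_of_subset_of_forall_sdiff_eq_zero e'.open_target.measurableSet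
      Set.inter_subset_left fun u hu ↦ ?_
    rw [hF _ fun h ↦ hu.2 ⟨hu.1, h.1⟩, zero_mul]
  rw [h1, h2, integral_image_eq_integral_abs_det_fderiv_smul volume hso.measurableSet
    (fun u hu ↦ (hφd u hu).hasFDerivAt.hasFDerivWithinAt) hinj]
  refine setIntegral_congr_fun hso.measurableSet fun u hu ↦ ?_
  have hrep := (coordRep_eventuallyEq σ.1 he he' hu.1 hu.2).self_of_nhds
  have hn := det_coordRep_ne_zero hσ he hu.1
  have hn' := det_coordRep_ne_zero hσ he' (e'.map_source hu.2)
  simp only [hφ, e'.left_inv hu.2, smul_eq_mul]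
  rw [hrep, formMatrix_comp] at hn ⊢
  -- The two matrices of `σ` differ by congruence with the derivative of the transition map, so the
  -- density supplies exactly the Jacobian. That derivative is invertible because `hn` is a nonzero
  -- product containing its determinant.
  rw [density_congr _ hn', det_endMatrix]
  · ring
  · rw [det_mul] at hn
    exact right_ne_zero_of_mul hn

lemma contDiffOn_pairAt {σ : Form (Euc m) M 2} (hσ : ∀ x, (formMatrix (evalAt x σ)).det ≠ 0)
    (he : e ∈ IsManifold.maximalAtlas 𝓘(ℝ, Euc m) ∞ M) (β ξ : Form (Euc m) M 2) :
    ContDiffOn ℝ ∞ (fun u ↦ pairAt σ β (e.symm u) ξ) e.target :=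
  (contDiffOn_pairing (contDiffOn_formMatrix (σ.2 e he)) (fun _ hu ↦ det_coordRep_ne_zero hσ he hu)
    (contDiffOn_formMatrix (ξ.2 e he)) (contDiffOn_formMatrix (β.2 e he))).congr
      fun _ hu ↦ (pairing_coordRep he hu σ β ξ).symm

lemma continuousOn_density_coordRep {σ : Form (Euc m) M 2}
    (hσ : ∀ x, (formMatrix (evalAt x σ)).det ≠ 0)
    (he : e ∈ IsManifold.maximalAtlas 𝓘(ℝ, Euc m) ∞ M) :
    ContinuousOn (fun u ↦ density (formMatrix (coordRep e σ.1 u))) e.target :=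
  (contDiffOn_density (contDiffOn_formMatrix (σ.2 e he))
    fun _ hu ↦ det_coordRep_ne_zero hσ he hu).continuousOn

lemma integrableOn_chart {σ : Form (Euc m) M 2} (hσ : ∀ x, (formMatrix (evalAt x σ)).det ≠ 0)
    (he : e ∈ IsManifold.maximalAtlas 𝓘(ℝ, Euc m) ∞ M) {F : M → ℝ}
    (hF : ContinuousOn (fun u ↦ F (e.symm u)) e.target) {C : Set M} (hC : IsCompact C)
    (hCe : C ⊆ e.source) (hFC : ∀ x ∉ C, F x = 0) :
    IntegrableOn (fun u ↦ F (e.symm u) * density (formMatrix (coordRep e σ.1 u))) e.target := by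
  refine integrableOn_of_vanish_off_compact (K := e '' C) e.open_target
    (hC.image_of_continuousOn (e.continuousOn.mono hCe)) ?_
    (hF.mul (continuousOn_density_coordRep hσ he)) fun u hu hu' ↦ ?_
  · rintro _ ⟨x, hx, rfl⟩; exact e.map_source (hCe hx)
  · rw [hFC _ (notMem_of_notMem_image hu hu'), zero_mul]

lemma contDiffOn_comp_chart_symm (he : e ∈ IsManifold.maximalAtlas 𝓘(ℝ, Euc m) ∞ M) {ρ : M → ℝ}
    (hρ : ContMDiff 𝓘(ℝ, Euc m) 𝓘(ℝ) ∞ ρ) : ContDiffOn ℝ ∞ (fun u ↦ ρ (e.symm u)) e.target := by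
  rw [← contMDiffOn_iff_contDiffOn]
  exact hρ.comp_contMDiffOn (contMDiffOn_symm_of_mem_maximalAtlas he)

/-- The product of a smooth function and a smooth form. -/
noncomputable def mulForm (ρ : M → ℝ) (hρ : ContMDiff 𝓘(ℝ, Euc m) 𝓘(ℝ) ∞ ρ) (γ : Form (Euc m) M k) :
    Form (Euc m) M k :=
  ⟨fun x ↦ ρ x • γ x, fun e he ↦ (contDiffOn_comp_chart_symm he hρ).smul (γ.2 e he)⟩

lemma coordRep_mulForm (ρ : M → ℝ) (hρ : ContMDiff 𝓘(ℝ, Euc m) 𝓘(ℝ) ∞ ρ)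
    (γ : Form (Euc m) M k) (u : Euc m) :
    coordRep e (mulForm ρ hρ γ).1 u = ρ (e.symm u) • coordRep e γ.1 u := rfl

variable [IsManifold 𝓘(ℝ, Euc m) ∞ M]

/-- The exterior derivative is local, and off the closed support the form vanishes on a whole
neighbourhood. -/
lemma evalAt_d_mulForm {ρ : M → ℝ} (hρ : ContMDiff 𝓘(ℝ, Euc m) 𝓘(ℝ) ∞ ρ)
    (γ : Form (Euc m) M k) {x : M} (hx : x ∉ tsupport ρ) :
    evalAt x (d (Euc m) M k (mulForm ρ hρ γ)) = 0 := by
  have hev : coordRep (chartAt (Euc m) x) (mulForm ρ hρ γ).1 =ᶠ[𝓝 (chartAt (Euc m) x x)]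
      fun _ ↦ 0 := by
    have hc := (chartAt (Euc m) x).continuousAt_symm (mem_chart_target (Euc m) x)
    rw [ContinuousAt, (chartAt (Euc m) x).left_inv (mem_chart_source _ x)] at hc
    filter_upwards [hc.eventually ((isClosed_tsupport ρ).isOpen_compl.mem_nhds hx)] with w hw
    rw [coordRep_mulForm, image_eq_zero_of_notMem_tsupport hw, zero_smul]
  change roughExtDeriv (mulForm ρ hρ γ).1 x = 0
  rw [roughExtDeriv, hev.extDeriv_eq]
  have : extDeriv (fun _ : Euc m ↦ (0 : (Euc m) [⋀^Fin k]→L[ℝ] ℝ)) (chartAt (Euc m) x x) = 0 := by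
    rw [extDeriv, fderiv_const_apply]
    exact map_zero (ContinuousAlternatingMap.alternatizeUncurryFinCLM ℝ (Euc m) ℝ)
  rw [this]
  rfl

lemma extDeriv_coordRep_of_closed {α : Form (Euc m) M k} (hα : d (Euc m) M k α = 0)
    (he : e ∈ IsManifold.maximalAtlas 𝓘(ℝ, Euc m) ∞ M) {u : Euc m} (hu : u ∈ e.target) :
    extDeriv (coordRep e α.1) u = 0 := by
  rw [← coordRep_roughExtDeriv α.2 he hu]
  have h0 : roughExtDeriv α.1 = 0 := congrArg Subtype.val hα
  rw [h0, coordRep_zero]; rfl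

/-- Integration by parts in a chart. -/
lemma chartIntegral_pairAt_eq_zero {σ β : Form (Euc m) M 2}
    (hσ : ∀ x, (formMatrix (evalAt x σ)).det ≠ 0) (cσ : d (Euc m) M 2 σ = 0)
    (cβ : d (Euc m) M 2 β = 0)
    (htr : ∀ x, trace ((formMatrix (evalAt x σ))⁻¹ * formMatrix (evalAt x β)) = 0)
    (he : e ∈ IsManifold.maximalAtlas 𝓘(ℝ, Euc m) ∞ M) (γ : Form (Euc m) M 1) {C : Set M}
    (hC : IsCompact C) (hCe : C ⊆ e.source) (hγ : ∀ x ∉ C, evalAt x γ = 0) :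
    chartIntegral σ e (fun x ↦ pairAt σ β x (d (Euc m) M 1 γ)) = 0 := by
  rw [chartIntegral, ← setIntegral_pairing_extDeriv_eq_zero e.open_target (σ.2 e he) (β.2 e he)
    (fun u hu ↦ det_coordRep_ne_zero hσ he hu) (fun u hu ↦ extDeriv_coordRep_of_closed cσ he hu)
    (fun u hu ↦ extDeriv_coordRep_of_closed cβ he hu)
    (fun u hu ↦ (trace_inv_mul_coordRep he hu σ β).trans (htr _)) (γ.2 e he) (K := e '' C)
    (hC.image_of_continuousOn (e.continuousOn.mono hCe))
    (by rintro _ ⟨x, hx, rfl⟩; exact e.map_source (hCe hx))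
    (fun u hu hu' ↦ by
      have := hγ _ (notMem_of_notMem_image hu hu')
      change (evalAt (e.symm u) γ).compContinuousLinearMap _ = 0
      rw [this]; rfl)]
  refine setIntegral_congr_fun e.open_target.measurableSet fun u hu ↦ ?_
  have h := coordRep_roughExtDeriv γ.2 he hu
  have h' := pairing_coordRep he hu σ β (d (Euc m) M 1 γ)
  change _ = pairing _ (formMatrix (extDeriv (coordRep e γ.1) u)) _ * _
  rw [← h, ← h']
  rfl

/-- On a compact symplectic manifold, if the pairing of an exact 2-form with a closed primitive
2-form is nonnegative, it vanishes. -/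
theorem pairAt_exact_eq_zero [T2Space M] [CompactSpace M] {σ β : Form (Euc m) M 2}
    (hσ : ∀ x, (formMatrix (evalAt x σ)).det ≠ 0) (cσ : d (Euc m) M 2 σ = 0)
    (cβ : d (Euc m) M 2 β = 0)
    (htr : ∀ x, trace ((formMatrix (evalAt x σ))⁻¹ * formMatrix (evalAt x β)) = 0)
    (γ : Form (Euc m) M 1) (hnn : ∀ x, 0 ≤ pairAt σ β x (d (Euc m) M 1 γ)) (x : M) :
    pairAt σ β x (d (Euc m) M 1 γ) = 0 := by
  -- Finitely many charts make every sum over the partition of unity finite.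
  obtain ⟨t, ht⟩ := isCompact_univ.elim_finite_subcover
    (fun y : M ↦ (chartAt (Euc m) y).source) (fun y ↦ (chartAt (Euc m) y).open_source)
    (fun y _ ↦ Set.mem_iUnion_of_mem y (mem_chart_source (Euc m) y))
  obtain ⟨ρ, hρ⟩ := SmoothPartitionOfUnity.exists_isSubordinate 𝓘(ℝ, Euc m) isClosed_univ
    (fun i : t ↦ (chartAt (Euc m) i.1).source) (fun i ↦ (chartAt (Euc m) i.1).open_source)
    (fun y hy ↦ by
      obtain ⟨i, hi, hy'⟩ := Set.mem_iUnion₂.1 (ht hy)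
      exact Set.mem_iUnion_of_mem ⟨i, hi⟩ hy')
  have hsum : ∀ y, ∑ i, ρ i y = 1 := fun y ↦ by
    rw [← ρ.sum_eq_one (Set.mem_univ y), finsum_eq_sum_of_fintype]
  let c : t → OpenPartialHomeomorph M (Euc m) := fun i ↦ chartAt (Euc m) i.1
  have hc : ∀ i, c i ∈ IsManifold.maximalAtlas 𝓘(ℝ, Euc m) ∞ M := fun i ↦
    IsManifold.chart_mem_maximalAtlas i.1
  have hρs : ∀ i, ContMDiff 𝓘(ℝ, Euc m) 𝓘(ℝ) ∞ (ρ i) := fun i ↦ (ρ i).contMDiff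
  have hK : ∀ i, IsCompact (tsupport (ρ i)) := fun i ↦ (isClosed_tsupport _).isCompact
  let γ' : t → Form (Euc m) M 1 := fun j ↦ mulForm (ρ j) (hρs j) γ
  have hγ' : γ = ∑ j, γ' j := by
    refine evalAt_injective fun y ↦ ?_
    rw [map_sum]
    change _ = ∑ j, ρ j y • evalAt y γ
    rw [← Finset.sum_smul, hsum, one_smul]
  let f : t → M → ℝ := fun j y ↦ pairAt σ β y (d (Euc m) M 1 (γ' j))
  have hf : ∀ y, pairAt σ β y (d (Euc m) M 1 γ) = ∑ j, f j y := by
    intro y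
    conv_lhs => rw [hγ']
    rw [map_sum, map_sum]
  have hf0 : ∀ j, ∀ y ∉ tsupport (ρ j), f j y = 0 := by
    intro j y hy
    change pairAt σ β y _ = 0
    rw [pairAt_apply, evalAt_d_mulForm (hρs j) γ hy, formMatrix_zero, pairing_zero_left]
  have hρ0 : ∀ j, ∀ y ∉ tsupport (ρ j), ρ j y = 0 := fun j y hy ↦
    image_eq_zero_of_notMem_tsupport hy
  have hfc : ∀ i j, ContinuousOn (fun u ↦ f j ((c i).symm u)) (c i).target := fun i j ↦
    (contDiffOn_pairAt hσ (hc i) β _).continuousOn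
  have hρc : ∀ i j, ContinuousOn (fun u ↦ ρ j ((c i).symm u)) (c i).target := fun i j ↦
    (contDiffOn_comp_chart_symm (hc i) (hρs j)).continuousOn
  have hI0 : ∀ j, chartIntegral σ (c j) (f j) = 0 := by
    intro j
    refine chartIntegral_pairAt_eq_zero hσ cσ cβ htr (hc j) (γ' j) (hK j) (hρ j) fun y hy ↦ ?_
    change ρ j y • evalAt y γ = 0
    rw [hρ0 j y hy, zero_smul]
  have hsplit : ∀ (i : t) (G : t → M → ℝ)
      (_ : ∀ j, ContinuousOn (fun u ↦ G j ((c i).symm u)) (c i).target)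
      (_ : ∀ j, ∀ y ∉ tsupport (ρ i), G j y = 0),
      chartIntegral σ (c i) (fun y ↦ ∑ j, G j y) = ∑ j, chartIntegral σ (c i) (G j) := by
    intro i G hG hG0
    simp only [chartIntegral, Finset.sum_mul]
    exact integral_finsetSum _ fun j _ ↦
      integrableOn_chart hσ (hc i) (hG j) (hK i) (hρ i) (hG0 j)
  -- The sum over `i` plays the role of the global integral of `f j`. Each `ρ i * f j` is supported
  -- in the overlap of charts `i` and `j`, so it can be integrated in chart `j`, where the sum is
  -- the integral of `f j`, zero by `hI0`.
  have hj : ∀ j, ∑ i, chartIntegral σ (c i) (fun y ↦ ρ i y * f j y) = 0 := by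
    intro j
    rw [← hI0 j]
    have : f j = fun y ↦ ∑ i, ρ i y * f j y := by
      ext y; rw [← Finset.sum_mul, hsum, one_mul]
    conv_rhs => rw [this]
    rw [hsplit j (fun i y ↦ ρ i y * f j y) (fun i ↦ (hρc j i).mul (hfc j j))
      (fun i y hy ↦ by rw [hf0 j y hy, mul_zero])]
    refine Finset.sum_congr rfl fun i _ ↦ chartIntegral_congr hσ (hc i) (hc j) fun y hy ↦ ?_
    by_cases hi : y ∈ tsupport (ρ i)
    · rw [hf0 j y fun h ↦ hy ⟨hρ i hi, hρ j h⟩, mul_zero]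
    · rw [hρ0 i y hi, zero_mul]
  have htot : ∑ i, chartIntegral σ (c i)
      (fun y ↦ ρ i y * pairAt σ β y (d (Euc m) M 1 γ)) = 0 := by
    simp only [hf, Finset.mul_sum]
    rw [← Finset.sum_const_zero (s := (Finset.univ : Finset t)),
      ← Finset.sum_congr rfl fun j _ ↦ hj j, Finset.sum_comm]
    exact Finset.sum_congr rfl fun i _ ↦ hsplit i (fun j y ↦ ρ i y * f j y)
      (fun j ↦ (hρc i i).mul (hfc i j)) (fun j y hy ↦ by rw [hρ0 i y hy, zero_mul])
  have hnn' : ∀ i u, 0 ≤ ρ i ((c i).symm u) * pairAt σ β ((c i).symm u) (d (Euc m) M 1 γ) *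
      density (formMatrix (coordRep (c i) σ.1 u)) := fun i u ↦
    mul_nonneg (mul_nonneg (ρ.nonneg i _) (hnn _)) (density_pos _).le
  -- A vanishing sum of nonnegative integrals has vanishing terms; continuity then upgrades almost
  -- everywhere zero to zero on each chart target.
  have hzero := (Finset.sum_eq_zero_iff_of_nonneg fun i _ ↦
    integral_nonneg fun u ↦ hnn' i u).1 htot
  have hcont : ∀ i, ContinuousOn
      (fun u ↦ ρ i ((c i).symm u) * pairAt σ β ((c i).symm u) (d (Euc m) M 1 γ)) (c i).target :=
    fun i ↦ (hρc i i).mul (contDiffOn_pairAt hσ (hc i) β _).continuousOn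
  have hpt : ∀ i, ∀ u ∈ (c i).target,
      ρ i ((c i).symm u) * pairAt σ β ((c i).symm u) (d (Euc m) M 1 γ) = 0 := by
    intro i u hu
    have hint := integrableOn_chart hσ (hc i)
      (F := fun y ↦ ρ i y * pairAt σ β y (d (Euc m) M 1 γ)) (hcont i) (hK i) (hρ i)
      (fun y hy ↦ by rw [hρ0 i y hy, zero_mul])
    have hae := (setIntegral_eq_zero_iff_of_nonneg_ae (.of_forall fun u ↦ hnn' i u) hint).1
      (hzero i (Finset.mem_univ i))
    have := Measure.eqOn_open_of_ae_eq hae (c i).open_target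
      ((hcont i).mul (continuousOn_density_coordRep hσ (hc i))) continuousOn_const hu
    exact (mul_eq_zero.1 this).resolve_right (density_pos _).ne'
  rw [← one_mul (pairAt σ β x (d (Euc m) M 1 γ)), ← hsum x, Finset.sum_mul]
  refine Finset.sum_eq_zero fun i _ ↦ ?_
  by_cases hi : x ∈ tsupport (ρ i)
  · have hx : x ∈ (c i).source := hρ i hi
    have := hpt i (c i x) ((c i).map_source hx)
    rwa [(c i).left_inv hx] at this
  · rw [hρ0 i x hi, zero_mul]

end Global

/-! ### Purity of calibrated almost complex structures -/

section Calibrated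

open Matrix DeRham

variable {m : ℕ} {M : Type*} [TopologicalSpace M] [ChartedSpace (Euc m) M]
  [IsManifold 𝓘(ℝ, Euc m) ∞ M]

/-- The value of an almost complex structure at a point, as an endomorphism of the model space. -/
noncomputable def endAt (J : AlmostComplexStructure (Euc m) M) (x : M) : Euc m →L[ℝ] Euc m := J x

/-- The matrix of an almost complex structure at a point. -/
noncomputable def complexMatrix (J : AlmostComplexStructure (Euc m) M) (x : M) :
    Matrix (Fin m) (Fin m) ℝ :=
  endMatrix (endAt J x)

lemma complexMatrix_sq (J : AlmostComplexStructure (Euc m) M) (x : M) :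
    complexMatrix J x * complexMatrix J x = -1 := by
  rw [complexMatrix, ← endMatrix_mul]
  have : (endAt J x).comp (endAt J x) =
      -ContinuousLinearMap.id ℝ (Euc m) := ContinuousLinearMap.ext fun u ↦ J.sq_eq_neg' x u
  rw [this]
  have h : endMatrix (-ContinuousLinearMap.id ℝ (Euc m)) =
      -LinearMap.toMatrix (stdBasis m) (stdBasis m) LinearMap.id := map_neg _ _
  rw [h, LinearMap.toMatrix_id]

lemma formMatrix_evalAt_conj (J : AlmostComplexStructure (Euc m) M) (α : Form (Euc m) M 2) (x : M)
    (i j : Fin m) : ((complexMatrix J x)ᵀ * formMatrix (evalAt x α) * complexMatrix J x) i j =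
      α x ![J x (stdBasis m i), J x (stdBasis m j)] := by
  rw [complexMatrix, ← formMatrix_comp]
  change evalAt x α (endAt J x ∘ ![stdBasis m i, stdBasis m j]) =
    evalAt x α ![endAt J x (stdBasis m i), endAt J x (stdBasis m j)]
  congr 1
  ext1 a; fin_cases a <;> rfl

/-- An almost complex structure calibrated by a symplectic form on a compact manifold is
smoothly pure. -/
theorem isSmoothPure_of_isCalibratedBy [T2Space M] [CompactSpace M] {σ : Form (Euc m) M 2}
    (hσ : IsSymplectic σ) {J : AlmostComplexStructure (Euc m) M} (hJ : J.IsCalibratedBy σ) :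
    J.IsSmoothPure := by
  have hdet : ∀ x, (formMatrix (evalAt x σ)).det ≠ 0 := fun x ↦
    det_formMatrix_ne_zero (hσ.nondegenerate x)
  have hunit : ∀ x, IsUnit (formMatrix (evalAt x σ)).det := fun x ↦ isUnit_iff_ne_zero.2 (hdet x)
  have hJJ := complexMatrix_sq J
  have hinv : ∀ x, (complexMatrix J x)ᵀ * formMatrix (evalAt x σ) * complexMatrix J x =
      formMatrix (evalAt x σ) := fun x ↦ by
    ext i j
    rw [formMatrix_evalAt_conj]; exact hJ.invariant x _ _
  have hpos : ∀ x (v : Fin m → ℝ), v ≠ 0 →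
      0 < v ⬝ᵥ (formMatrix (evalAt x σ) * complexMatrix J x) *ᵥ v := fun x v hv ↦ by
    have h := hJ.tamed x (WithLp.toLp 2 v : Euc m)
      fun h0 ↦ hv (congrArg (WithLp.ofLp (p := 2) (V := Fin m → ℝ)) h0)
    have h' := formBilin_eq_dotProduct (evalAt x σ) (WithLp.toLp 2 v)
      (endAt J x (WithLp.toLp 2 v))
    rw [← endMatrix_mulVec] at h'
    rw [← mulVec_mulVec]
    exact h.trans_eq h'
  rw [AlmostComplexStructure.IsSmoothPure, eq_bot_iff]
  rintro _ ⟨⟨α, hα, rfl⟩, ⟨β, hβ, hαβ⟩⟩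
  obtain ⟨γ, hγ⟩ : (α : Form (Euc m) M 2) - β ∈ exactForms (Euc m) M 1 :=
    (Submodule.Quotient.eq ((exactForms (Euc m) M 1).submoduleOf
      (closedForms (Euc m) M 2))).1 hαβ.symm
  have hα' : ∀ x, (complexMatrix J x)ᵀ * formMatrix (evalAt x α.1) * complexMatrix J x =
      formMatrix (evalAt x α.1) := fun x ↦ by
    ext i j
    rw [formMatrix_evalAt_conj]; exact hα x _ _
  have hβ' : ∀ x, (complexMatrix J x)ᵀ * formMatrix (evalAt x β.1) * complexMatrix J x =
      -formMatrix (evalAt x β.1) := fun x ↦ by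
    ext i j
    rw [formMatrix_evalAt_conj]; exact hβ x _ _
  have hdef := fun x ↦ pairing_antiInvariant_self (formMatrix_transpose (evalAt x σ)) (hJJ x)
    (hinv x) (hpos x) (hunit x) (formMatrix_transpose (evalAt x β.1)) (hβ' x)
  -- Since `dγ = α - β` and `α` is orthogonal to `β`, only the self-pairing of `β` survives.
  have hpair : ∀ x, pairAt σ β.1 x (d (Euc m) M 1 γ) = -pairing (formMatrix (evalAt x σ))
      (formMatrix (evalAt x β.1)) (formMatrix (evalAt x β.1)) := fun x ↦ by
    rw [hγ, map_sub, pairAt_apply, pairAt_apply,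
      pairing_invariant_antiInvariant (hunit x) (hJJ x) (hinv x) (hα' x) (hβ' x), zero_sub]
  have hzero := pairAt_exact_eq_zero hdet hσ.closed β.2
    (fun x ↦ trace_inv_mul_of_antiInvariant (hunit x) (hJJ x) (hinv x) (hβ' x)) γ
    (fun x ↦ by rw [hpair x]; exact neg_nonneg.2 (hdef x).1)
  have hβ0 : β = 0 := by
    refine Subtype.ext (evalAt_injective fun x ↦ formMatrix_injective ?_)
    have h0 := hzero x
    rw [hpair x, neg_eq_zero] at h0
    exact (hdef x).2 h0
  rw [← hαβ, hβ0, map_zero]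
  exact Submodule.zero_mem _

end Calibrated

end CalibratedPure

theorem proposition3 (n : ℕ) {M : Type*} [TopologicalSpace M] [T2Space M] [CompactSpace M]
    [ChartedSpace (EuclideanSpace ℝ (Fin (2 * n))) M]
    [IsManifold 𝓘(ℝ, EuclideanSpace ℝ (Fin (2 * n))) ∞ M]
    (σ : DeRham.Form (EuclideanSpace ℝ (Fin (2 * n))) M 2) (hσ : IsSymplectic σ)
    (J : AlmostComplexStructure (EuclideanSpace ℝ (Fin (2 * n))) M)
    (hJ : J.IsCalibratedBy σ) :
    J.IsSmoothPure :=
  CalibratedPure.isSmoothPure_of_isCalibratedBy hσ hJ
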